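/- **Setting.** Let $d\ge 1$, let $\xi\sim\mathcal D$, let $f(\cdot;\xi):\mathbb R^d\to\mathbb R$ be $C^2$ for every $\xi$ and $f(x;\cdot)$ measurable and integrable for every $x$, and put $f(x)=\mathbb E_{\xi\sim\mathcal D}f(x;\xi)$. Assume that $f$ is twice differentiable and bounded below by $f^*$, with $\ell$-Lipschitz gradient and $\rho$-Lipschitz Hessian ($\ell,\rho>0$), and that for every $x$ $$\mathbb E\|\nabla f(x;\xi)-\nabla f(x)\|^2\le\sigma_1^2,\quad \|\nabla f(x;\xi)-\nabla f(x)\|\le M_1\ \text{a.s.},\quad \mathbb E\|\nabla^2 f(x;\xi)-\nabla^2 f(x)\|^2\le\sigma_2^2,\quad \|\nabla^2 f(x;\xi)-\nabla^2 f(x)\|\le M_2\ \text{a.s.}$$ A point $x$ is an $\epsilon$-second-order stationary point if $\|\nabla f(x)\|\le\epsilon$ and $\lambda_{\min}(\nabla^2 f(x))\ge-\sqrt{\rho\epsilon}$. For $g\in\mathbb R^d$ and symmetric $B$ let $\tilde m(\Delta)=\Delta^\top g+\frac12\Delta^\top B\Delta+\frac\rho6\|\Delta\|^3$, with global minimizer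 $\Delta^\star$. **Algorithm** (inputs $n_1,n_2,T_{\rm out},x_0,\epsilon$ and a constant $\kappa$). For $t=0,\dots,T_{\rm out}$: draw fresh independent minibatches of sizes $n_1$ and $n_2$ from $\mathcal D$; let $g_t$ be the average of the $\nabla f(x_t;\xi_i)$ over the first and $B_t$ the average of the $\nabla^2f(x_t;\xi_i)$ over the second; call the Cubic-Subsolver, which receives $g_t$, accesses $B_t$ only through products $B_t[v]$, may use fresh internal randomness, and returns $\Delta$ and $\Delta_m$; put $x_{t+1}=x_t+\Delta$. If $\Delta_m\ge-\kappa\sqrt{\epsilon^3/\rho}$, run the final solver: gradient descent on $\tilde m$ (with $g=g_t$, $B=B_t$) from $0$ with step size $\frac1{20\ell}$, stopped as soon as $\|\nabla\tilde m\|\le\epsilon/2$; output $x_t$ plus its result and stop. If this never happens, output $x_{T_{\rm out}+1}$. Computing $g_t$ costs $n_1$ evaluations, and each product $B_t[v]$ (in the subsolver or in the final solver) costs $n_2$. **Subsolver condition** with constants $K,\tau,c$, query bound $\mathcal T(\epsilon)$ and failure probability $q$: for all $x,g$ and symmetric $B$ with $\|g-\nabla f(x)\|\le\tau\epsilon$ and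 $\|B-\nabla^2f(x)\|\le\tau\sqrt{\rho\epsilon}$, with probability at least $1-q$ over its internal randomness the subsolver, run on $(g,B)$, makes at most $\mathcal T(\epsilon)$ products $B[v]$ and returns $\Delta$ and $\Delta_m=\tilde m(\Delta)$ such that at least one of the following holds: 1. $\max\{\tilde m(\Delta),\,f(x+\Delta)-f(x)\}\le-K\sqrt{\epsilon^3/\rho}$; 2. $\|\Delta\|\le\|\Delta^\star\|+c\sqrt{\epsilon/\rho}$ and, if $\|\Delta^\star\|\ge\frac12\sqrt{\epsilon/\rho}$, then $\tilde m(\Delta)\le\tilde m(\Delta^\star)+\frac c{12}\rho\|\Delta^\star\|^3$. ($q=0$ covers deterministic subsolvers. The outputs and the number of products are assumed to depend measurably on the randomness and the input.) **Theorem.** Let $K,\kappa,\tau$ be constants with $0<\kappa\le\frac1{100}$, $\kappa<K$ and $\tau>0$. There are constants $c,C>0$, depending only on $K,\kappa,\tau$, such that the following holds in the above setting for all $\epsilon,\delta>0$ and all $\Delta_f\ge f(x_0)-f^*$ with $\sqrt\rho\,\Delta_f\ge\epsilon^{1.5}$. Write $$X=\frac{\sqrt\rho\,\Delta_f}{\epsilon^{1.5}},\quad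 L=\log\frac{d\sqrt\rho\,\Delta_f}{\epsilon^{1.5}\delta c},\quad G=\max\Big(\frac{M_1}{\epsilon},\frac{\sigma_1^2}{\epsilon^2}\Big),\quad H=\max\Big(\frac{M_2}{\sqrt{\rho\epsilon}},\frac{\sigma_2^2}{\rho\epsilon}\Big),$$ $$N_1=\max\Big(\frac{M_1}{c\epsilon},\frac{\sigma_1^2}{c^2\epsilon^2}\Big)L,\qquad N_2=\max\Big(\frac{M_2}{c\sqrt{\rho\epsilon}},\frac{\sigma_2^2}{c^2\rho\epsilon}\Big)L .$$ Suppose that the subsolver satisfies the condition with $K,\tau,c$, $\mathcal T(\epsilon)$ and $q=c\delta/X$, that $n_1\ge\max(1,N_1)$ and $n_2\ge\max(1,N_2)$ are integers, and that $T_{\rm out}\ge X/c$. Then with probability at least $1-\delta$ the algorithm outputs an $\epsilon$-second-order stationary point of $f$, and its total number of stochastic gradient and Hessian-vector product evaluations is at most $$C\Big(X\big(n_1+n_2\,\mathcal T(\epsilon)\big)+n_2\,\frac{\ell^2}{\rho\epsilon}\Big),$$ where the last term is the cost of the single call of the final solver. If moreover $n_1\le N_1+1$ and $n_2\le N_2+1$,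 then (in the same event) this total is at most $$C\,L\Big(X\big((1+G)+(1+H)\,\mathcal T(\epsilon)\big)+(1+H)\frac{\ell^2}{\rho\epsilon}\Big),$$ and if in addition $\frac{\ell^2}{\rho\epsilon}\le X\,\mathcal T(\epsilon)$ (which for fixed $\ell,\rho,\Delta_f$ and $\mathcal T(\epsilon)\ge1$ holds for all small $\epsilon$), it is at most $$C\,L\,\frac{\sqrt\rho\,\Delta_f}{\epsilon^{1.5}}\Big(1+\max\Big(\frac{M_1}{\epsilon},\frac{\sigma_1^2}{\epsilon^2}\Big)+\Big(1+\max\Big(\frac{M_2}{\sqrt{\rho\epsilon}},\frac{\sigma_2^2}{\rho\epsilon}\Big)\Big)\mathcal T(\epsilon)\Big).$$ -/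

import Mathlib

open MeasureTheory

noncomputable section

namespace StochCubic

/-- `ℝᵈ` with the Euclidean norm; the operator norm on `Vec d →L[ℝ] Vec d` is the spectral norm. -/
abbrev Vec (d : ℕ) : Type := EuclideanSpace ℝ (Fin d)

/-- The Hessian of `F` at `x`, as the derivative of the gradient field. -/
def hessian {d : ℕ} (F : Vec d → ℝ) (x : Vec d) : Vec d →L[ℝ] Vec d :=
  fderiv ℝ (gradient F) x

/-- The objective `F x = 𝔼_{ξ ∼ D} f(x; ξ)`. -/
def objective {d : ℕ} {Ξ : Type*} [MeasurableSpace Ξ] (D : Measure Ξ) (f : Vec d → Ξ → ℝ)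
    (x : Vec d) : ℝ :=
  ∫ ξ, f x ξ ∂D

/-- What it takes for the objective, the stochastic gradients and the stochastic Hessians
to be defined: `f(·; ξ)` is `C²`, and `f(x; ·)` is measurable and integrable. -/
structure IsStochasticFunction {d : ℕ} {Ξ : Type*} [MeasurableSpace Ξ] (D : Measure Ξ)
    (f : Vec d → Ξ → ℝ) : Prop where
  contDiff : ∀ ξ, ContDiff ℝ 2 (fun x => f x ξ)
  measurable : ∀ x, Measurable (fun ξ => f x ξ)
  integrable : ∀ x, Integrable (fun ξ => f x ξ) D

/-- `F` is twice differentiable with `ℓ`-Lipschitz gradient and `ρ`-Lipschitz Hessian. -/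
structure IsSmooth {d : ℕ} (F : Vec d → ℝ) (ℓ ρ : ℝ) : Prop where
  differentiable : Differentiable ℝ F
  differentiable_gradient : Differentiable ℝ (gradient F)
  gradient_lipschitz : ∀ x y, ‖gradient F x - gradient F y‖ ≤ ℓ * ‖x - y‖
  hessian_lipschitz : ∀ x y, ‖hessian F x - hessian F y‖ ≤ ρ * ‖x - y‖

/-- Bounded variance and almost sure boundedness of stochastic gradients and Hessians. -/
structure HasBoundedNoise {d : ℕ} {Ξ : Type*} [MeasurableSpace Ξ] (D : Measure Ξ)
    (f : Vec d → Ξ → ℝ) (σ₁ M₁ σ₂ M₂ : ℝ) : Prop where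
  gradient_variance : ∀ x,
    ∫ ξ, ‖gradient (fun y => f y ξ) x - gradient (objective D f) x‖ ^ 2 ∂D ≤ σ₁ ^ 2
  gradient_bounded : ∀ x,
    ∀ᵐ ξ ∂D, ‖gradient (fun y => f y ξ) x - gradient (objective D f) x‖ ≤ M₁
  hessian_variance : ∀ x,
    ∫ ξ, ‖hessian (fun y => f y ξ) x - hessian (objective D f) x‖ ^ 2 ∂D ≤ σ₂ ^ 2
  hessian_bounded : ∀ x,
    ∀ᵐ ξ ∂D, ‖hessian (fun y => f y ξ) x - hessian (objective D f) x‖ ≤ M₂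

/-- `ε`-second-order stationary points: `‖∇F(x)‖ ≤ ε` and `λ_min(∇²F(x)) ≥ -√(ρ ε)`. -/
def IsSecondOrderStationary {d : ℕ} (F : Vec d → ℝ) (ρ ε : ℝ) (x : Vec d) : Prop :=
  ‖gradient F x‖ ≤ ε ∧
    ∀ μ : ℝ, Module.End.HasEigenvalue (hessian F x : Vec d →ₗ[ℝ] Vec d) μ → -√(ρ * ε) ≤ μ

/-- The cubic submodel `m̃(Δ) = Δᵀ g + ½ Δᵀ B[Δ] + (ρ/6) ‖Δ‖³`. -/
def cubicModel {d : ℕ} (ρ : ℝ) (g : Vec d) (B : Vec d →L[ℝ] Vec d) (Δ : Vec d) : ℝ :=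
  inner ℝ Δ g + 1 / 2 * inner ℝ Δ (B Δ) + ρ / 6 * ‖Δ‖ ^ 3

/-- Its gradient `g + B[Δ] + (ρ/2) ‖Δ‖ Δ`. -/
def cubicModelGrad {d : ℕ} (ρ : ℝ) (g : Vec d) (B : Vec d →L[ℝ] Vec d) (Δ : Vec d) : Vec d :=
  g + B Δ + (ρ / 2 * ‖Δ‖) • Δ

/-! ### Cubic subsolvers -/

/-- A procedure on vectors that may adaptively query a black-box map `v ↦ B[v]` and finally
returns a parameter change together with a (claimed) change of the submodel value. -/
inductive OracleProc (V : Type) : Type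
  | ret (Δ : V) (Δm : ℝ) : OracleProc V
  | query (v : V) (next : V → OracleProc V) : OracleProc V

/-- The parameter change returned when the queries are answered by `B`. -/
def OracleProc.step {V : Type} (B : V → V) : OracleProc V → V
  | .ret Δ _ => Δ
  | .query v next => (next (B v)).step B

/-- The change of the submodel value returned when the queries are answered by `B`. -/
def OracleProc.decrease {V : Type} (B : V → V) : OracleProc V → ℝ
  | .ret _ Δm => Δm
  | .query v next => (next (B v)).decrease B

/-- The number of queries made when the queries are answered by `B`. -/
def OracleProc.queries {V : Type} (B : V → V) : OracleProc V → ℕ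
  | .ret _ _ => 0
  | .query v next => (next (B v)).queries B + 1

/-- A (possibly randomized) cubic subsolver: from its random seed and the vector `g` it
produces a procedure that accesses `B` through products `B[v]` only. -/
abbrev Subsolver (S : Type*) (d : ℕ) := S → Vec d → OracleProc (Vec d)

/-- The outputs of the subsolver depend measurably on its seed and its input. -/
structure Subsolver.IsMeasurable {S : Type*} [MeasurableSpace S] {d : ℕ}
    (A : Subsolver S d) : Prop where
  step : Measurable fun p : S × Vec d × (Vec d →L[ℝ] Vec d) => (A p.1 p.2.1).step p.2.2
  decrease : Measurable fun p : S × Vec d × (Vec d →L[ℝ] Vec d) => (A p.1 p.2.1).decrease p.2.2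
  queries : Measurable fun p : S × Vec d × (Vec d →L[ℝ] Vec d) => (A p.1 p.2.1).queries p.2.2

/-- Case 1: submodel and objective both decrease by at least `K √(ε³/ρ)`. -/
def SufficientDecrease {d : ℕ} (F : Vec d → ℝ) (ρ ε K : ℝ) (x g : Vec d)
    (B : Vec d →L[ℝ] Vec d) (Δ : Vec d) : Prop :=
  max (cubicModel ρ g B Δ) (F (x + Δ) - F x) ≤ -(K * √(ε ^ 3 / ρ))

/-- Case 2: `Δ` is an approximate global minimizer of the submodel. -/
def ApproxMinimizer {d : ℕ} (ρ ε c : ℝ) (g : Vec d) (B : Vec d →L[ℝ] Vec d)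
    (Δ : Vec d) : Prop :=
  ∃ Δs : Vec d, (∀ v, cubicModel ρ g B Δs ≤ cubicModel ρ g B v) ∧
    ‖Δ‖ ≤ ‖Δs‖ + c * √(ε / ρ) ∧
    (1 / 2 * √(ε / ρ) ≤ ‖Δs‖ →
      cubicModel ρ g B Δ ≤ cubicModel ρ g B Δs + c / 12 * (ρ * ‖Δs‖ ^ 3))

/-- The call of the procedure `P` at the iterate `x` with data `g, B` succeeds: it stops after
at most `T` products `B[v]` and returns `Δ` as in Case 1 or Case 2, with `Δm = m̃(Δ)`. -/
def CallSucceeds {d : ℕ} (F : Vec d → ℝ) (ρ ε K c : ℝ) (T : ℕ) (x g : Vec d)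
    (B : Vec d →L[ℝ] Vec d) (P : OracleProc (Vec d)) : Prop :=
  P.queries B ≤ T ∧
    P.decrease B = cubicModel ρ g B (P.step B) ∧
    (SufficientDecrease F ρ ε K x g B (P.step B) ∨ ApproxMinimizer ρ ε c g B (P.step B))

/-- The subsolver condition: each call at an iterate `x` whose data `g` and (symmetric) `B` are
accurate up to `τ ε` and `τ √(ρ ε)` succeeds, up to a failure probability `q` over the seed. -/
def SubsolverCondition {d : ℕ} {S : Type*} [MeasurableSpace S] (ν : Measure S)
    (F : Vec d → ℝ) (ρ ε K τ c : ℝ) (T : ℕ) (q : ℝ) (A : Subsolver S d) : Prop :=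
  ∀ (x g : Vec d) (B : Vec d →L[ℝ] Vec d), (B : Vec d →ₗ[ℝ] Vec d).IsSymmetric →
    ‖g - gradient F x‖ ≤ τ * ε → ‖B - hessian F x‖ ≤ τ * √(ρ * ε) →
      ν {s | ¬ CallSucceeds F ρ ε K c T x g B (A s g)} ≤ ENNReal.ofReal q

/-! ### The meta-algorithm -/

/-- Iterates of the final solver: gradient descent on the submodel from `0`, step `1/(20 ℓ)`. -/
def finalIterate {d : ℕ} (ℓ ρ : ℝ) (g : Vec d) (B : Vec d →L[ℝ] Vec d) : ℕ → Vec d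
  | 0 => 0
  | k + 1 => finalIterate ℓ ρ g B k -
      (1 / (20 * ℓ)) • cubicModelGrad ρ g B (finalIterate ℓ ρ g B k)

open Classical in
/-- The final solver: it stops at the first iterate at which the gradient of the submodel is at
most `ε/2`, and returns it with the number of descent steps (one product `B[v]` each);
`none` if the loop does not terminate. -/
def finalSolver {d : ℕ} (ℓ ρ ε : ℝ) (g : Vec d) (B : Vec d →L[ℝ] Vec d) :
    Option (Vec d × ℕ) :=
  if h : ∃ k, ‖cubicModelGrad ρ g B (finalIterate ℓ ρ g B k)‖ ≤ ε / 2 then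
    some (finalIterate ℓ ρ g B (Nat.find h), Nat.find h)
  else none

/-- The randomness of one outer iteration: two minibatches and a seed for the subsolver. -/
abbrev Round (Ξ S : Type*) (n₁ n₂ : ℕ) := (Fin n₁ → Ξ) × (Fin n₂ → Ξ) × S

/-- The average stochastic gradient over a minibatch. -/
def avgGradient {d : ℕ} {Ξ : Type*} (f : Vec d → Ξ → ℝ) {n : ℕ} (s : Fin n → Ξ)
    (x : Vec d) : Vec d :=
  (1 / (n : ℝ)) • ∑ i, gradient (fun y => f y (s i)) x

/-- The average stochastic Hessian over a minibatch. -/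
def avgHessian {d : ℕ} {Ξ : Type*} (f : Vec d → Ξ → ℝ) {n : ℕ} (s : Fin n → Ξ)
    (x : Vec d) : Vec d →L[ℝ] Vec d :=
  (1 / (n : ℝ)) • ∑ i, hessian (fun y => f y (s i)) x

open Classical in
/-- Stochastic cubic regularization from the iterate `x`, one list entry per outer iteration.
The result is the output point and the total number of stochastic gradient and Hessian-vector
evaluations: `n₁` for an average gradient, `n₂` for each product with an average Hessian.
It is `none` if the final solver is called and does not terminate. -/
def metaAlgorithm {d : ℕ} {Ξ S : Type*} (f : Vec d → Ξ → ℝ) (A : Subsolver S d)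
    (ℓ ρ ε κ : ℝ) {n₁ n₂ : ℕ} : List (Round Ξ S n₁ n₂) → Vec d → Option (Vec d × ℕ)
  | [], x => some (x, 0)
  | r :: rs, x =>
    let g := avgGradient f r.1 x
    let B := avgHessian f r.2.1 x
    let P := A r.2.2 g
    let cost := n₁ + n₂ * P.queries B
    if -(κ * √(ε ^ 3 / ρ)) ≤ P.decrease B then
      (finalSolver ℓ ρ ε g B).map fun o => (x + o.1, cost + n₂ * o.2)
    else
      (metaAlgorithm f A ℓ ρ ε κ rs (x + P.step B)).map fun o => (o.1, cost + o.2)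

/-- The law of `N` independent rounds: independent samples from `D`, independent seeds. -/
def roundsLaw {Ξ S : Type*} [MeasurableSpace Ξ] [MeasurableSpace S] (D : Measure Ξ)
    [SigmaFinite D] (ν : Measure S) [SigmaFinite ν] (n₁ n₂ N : ℕ) :
    Measure (Fin N → Round Ξ S n₁ n₂) :=
  Measure.pi fun _ => (Measure.pi fun _ : Fin n₁ => D).prod
    ((Measure.pi fun _ : Fin n₂ => D).prod ν)

/-! ### Quantities in the complexity bound -/

/-- `√ρ Δ_f / ε^{1.5}`. -/
def outerScale (ρ ε Δf : ℝ) : ℝ := √ρ * Δf / ε ^ (3 / 2 : ℝ)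

/-- `log (d √ρ Δ_f / (ε^{1.5} δ c))`. -/
def logFactor (d : ℕ) (ρ ε Δf δ c : ℝ) : ℝ :=
  Real.log (d * √ρ * Δf / (ε ^ (3 / 2 : ℝ) * δ * c))

/-- Threshold for `n₁`. -/
def gradThreshold (d : ℕ) (ρ ε Δf δ c σ₁ M₁ : ℝ) : ℝ :=
  max (M₁ / (c * ε)) (σ₁ ^ 2 / (c ^ 2 * ε ^ 2)) * logFactor d ρ ε Δf δ c

/-- Threshold for `n₂`. -/
def hessThreshold (d : ℕ) (ρ ε Δf δ c σ₂ M₂ : ℝ) : ℝ :=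
  max (M₂ / (c * √(ρ * ε))) (σ₂ ^ 2 / (c ^ 2 * ρ * ε)) * logFactor d ρ ε Δf δ c

/-- `max (M₁/ε, σ₁²/ε²)`. -/
def gradScale (ε σ₁ M₁ : ℝ) : ℝ := max (M₁ / ε) (σ₁ ^ 2 / ε ^ 2)

/-- `max (M₂/√(ρε), σ₂²/(ρε))`. -/
def hessScale (ρ ε σ₂ M₂ : ℝ) : ℝ := max (M₂ / √(ρ * ε)) (σ₂ ^ 2 / (ρ * ε))

end StochCubic

end

/-!
# Stochastic cubic regularization finds second-order stationary points

Put `r = √(ε / ρ)`, so that `ε = ρ r ^ 2` and `√(ε ^ 3 / ρ) = ρ r ^ 3`.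

*One round.* Suppose that `g` and `B` are accurate up to small multiples of `ρ r ^ 2` and `ρ r`, and
that the subsolver succeeds. A global minimizer `s` of the submodel satisfies
`m̃(s) ≤ -ρ ‖s‖ ^ 3 / 12` (`cubicModel_isMin_le`). Hence a claimed decrease of more than `κ ρ r ^ 3`
is a decrease of the objective by at least `κ ρ r ^ 3 / 4`
(`CallSucceeds.objective_decrease`), and a smaller claim means `‖s‖ ≤ r / 2`
(`CallSucceeds.exists_short_minimizer`). In the latter case `B + (ρ / 2) ‖s‖ I` is positive
semidefinite, which gives the curvature condition at every point `x + Δ` with `‖Δ‖ ≤ r / 2`, and the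
final solver reaches a small gradient without leaving that ball
(`isSecondOrderStationary_of_short`). That gradient descent from `0` keeps `‖Δ‖ ≤ ‖s‖` follows from
an ordering of its coordinates relative to those of `s` in an eigenbasis of `B`
(`IsScaled.step`); the number of steps then comes from the decrease of the submodel
(`exists_norm_cubicModelGrad_le`).

*Concentration.* The stochastic derivatives are unbiased by differentiation under the integral
(`hasFDerivAt_integral_of_close`). The Hessian average satisfies a matrix Bernstein inequality with
dimensional factor `2 d` (`measure_norm_average_gt_le`). Because the assumptions control the second
moment of the operator norm, no trace inequality beyond a second-order Taylor bound is needed: in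
eigenbases `u` of `A` and `v` of `B`, the difference
`tr (exp B) - tr (exp A) - tr ((B - A) exp A)` is a sum of scalar Taylor remainders of `exp` with
weights `⟪u i, v j⟫ ^ 2` (`traceExp_le_taylor`). Random vectors `v` are embedded as
the operators `v ⊗ e + e ⊗ v`.

*The run.* The objective cannot decrease in more than `4 X / κ` rounds, so only the first
`⌊4 X / κ⌋ + 1` rounds matter, however large the number of available rounds is
(`metaAlgorithm_of_allGood`). Each fails with probability at most `5 c δ / X` at every fixed
iterate, and the iterate of a round is independent of the randomness of that round
(`roundsLaw_not_allGood_le`).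
-/

noncomputable section

namespace StochCubic

/-! ### Trace exponentials of symmetric operators -/

section Spectral

variable {E : Type*} [NormedAddCommGroup E] [InnerProductSpace ℝ E]

theorem inner_eigenbasis_apply {ι : Type*} [Fintype ι] {A : E →L[ℝ] E}
    (hA : (A : E →ₗ[ℝ] E).IsSymmetric)
    {u : OrthonormalBasis ι ℝ E} {lam : ι → ℝ} (hu : ∀ i, A (u i) = lam i • u i) (i : ι) (x : E) :
    inner ℝ (u i) (A x) = lam i * inner ℝ (u i) x := by
  have h := hA (u i) x
  simp only [ContinuousLinearMap.coe_coe] at h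
  rw [← h, hu, real_inner_smul_left]

/-- A symmetric operator whose eigenvalues are at most `b` in absolute value has norm at most
`b`. -/
theorem norm_le_of_eigenvalues {ι : Type*} [Fintype ι] {A : E →L[ℝ] E}
    (hA : (A : E →ₗ[ℝ] E).IsSymmetric)
    {u : OrthonormalBasis ι ℝ E} {lam : ι → ℝ} (hu : ∀ i, A (u i) = lam i • u i)
    {b : ℝ} (hb : 0 ≤ b) (h : ∀ i, |lam i| ≤ b) : ‖A‖ ≤ b := by
  refine A.opNorm_le_bound hb fun x => ?_
  refine abs_le_of_sq_le_sq' ?_ (by positivity) |>.2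
  rw [mul_pow, ← u.sum_sq_inner_right, ← u.sum_sq_inner_right, Finset.mul_sum]
  refine Finset.sum_le_sum fun i _ => ?_
  rw [inner_eigenbasis_apply hA hu, mul_pow]
  gcongr ?_ * _
  exact sq_le_sq' (abs_le.1 (h i)).1 (abs_le.1 (h i)).2

theorem abs_eigenvalue_le {ι : Type*} [Fintype ι] {A : E →L[ℝ] E}
    {u : OrthonormalBasis ι ℝ E} {lam : ι → ℝ} (hu : ∀ i, A (u i) = lam i • u i) (i : ι) :
    |lam i| ≤ ‖A‖ := by
  have h := A.le_opNorm (u i)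
  rwa [hu, norm_smul, u.norm_eq_one, mul_one, mul_one] at h

variable [FiniteDimensional ℝ E]

theorem exists_eigenbasis {A : E →L[ℝ] E} (hA : (A : E →ₗ[ℝ] E).IsSymmetric) :
    ∃ (u : OrthonormalBasis (Fin (Module.finrank ℝ E)) ℝ E)
      (lam : Fin (Module.finrank ℝ E) → ℝ), ∀ i, A (u i) = lam i • u i :=
  ⟨hA.eigenvectorBasis rfl, hA.eigenvalues rfl, fun i =>
    hA.apply_eigenvectorBasis rfl i⟩

/-- The trace exponential `A ↦ tr (exp A)`, the Laplace functional of matrix concentration. -/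
def traceExp (A : E →L[ℝ] E) : ℝ :=
  LinearMap.trace ℝ E ((NormedSpace.exp A : E →L[ℝ] E) : E →ₗ[ℝ] E)

theorem exp_apply_eigenvector {A : E →L[ℝ] E} {v : E} {a : ℝ} (h : A v = a • v) :
    (NormedSpace.exp A : E →L[ℝ] E) v = Real.exp a • v := by
  have hpow : ∀ n : ℕ, (A ^ n) v = a ^ n • v := by
    intro n
    induction n with
    | zero => simp
    | succ n ih =>
      rw [pow_succ, mul_apply_eq_comp, h, map_smul, ih, smul_smul, pow_succ, mul_comm]
  have h1 := (NormedSpace.exp_series_hasSum_exp' (𝕂 := ℝ) A).mapL (ContinuousLinearMap.apply ℝ E v)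
  have h2 := ((NormedSpace.exp_series_hasSum_exp' (𝕂 := ℝ) a).smul_const v)
  rw [← Real.exp_eq_exp_ℝ] at h2
  refine h1.unique ?_
  convert h2 using 2 with n
  simp [hpow, smul_smul]

theorem traceExp_eq_sum {ι : Type*} [Fintype ι] {A : E →L[ℝ] E}
    {u : OrthonormalBasis ι ℝ E} {lam : ι → ℝ} (hu : ∀ i, A (u i) = lam i • u i) :
    traceExp A = ∑ i, Real.exp (lam i) := by
  rw [traceExp, LinearMap.trace_eq_sum_inner _ u]
  refine Finset.sum_congr rfl fun i _ => ?_
  rw [ContinuousLinearMap.coe_coe, exp_apply_eigenvector (hu i), real_inner_smul_right,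
    real_inner_self_eq_norm_sq, u.norm_eq_one]
  simp

theorem continuous_traceExp : Continuous (traceExp : (E →L[ℝ] E) → ℝ) := by
  have h : Continuous fun A : E →L[ℝ] E => LinearMap.trace ℝ E (A : E →ₗ[ℝ] E) :=
    ((LinearMap.trace ℝ E).comp (ContinuousLinearMap.coeLM ℝ)).continuous_of_finiteDimensional
  let _ : NormedAlgebra ℚ (E →L[ℝ] E) := NormedAlgebra.restrictScalars ℚ ℝ _
  exact h.comp NormedSpace.exp_continuous

theorem traceExp_nonneg {A : E →L[ℝ] E} (hA : (A : E →ₗ[ℝ] E).IsSymmetric) :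
    0 ≤ traceExp A := by
  obtain ⟨u, lam, hu⟩ := exists_eigenbasis hA
  rw [traceExp_eq_sum hu]
  positivity

theorem traceExp_zero : traceExp (0 : E →L[ℝ] E) = Module.finrank ℝ E := by
  rw [traceExp, NormedSpace.exp_zero]
  exact LinearMap.trace_one ℝ E

theorem exp_le_quadratic (x : ℝ) : Real.exp x ≤ 1 + x + x ^ 2 * (1 + Real.exp x) := by
  have h1 := Real.add_one_le_exp (-x)
  have h2 := Real.add_one_le_exp x
  have hp := Real.exp_pos x
  have h3 : Real.exp x * Real.exp (-x) = 1 := by rw [← Real.exp_add]; simp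
  have h4 : Real.exp x - 1 ≤ x * Real.exp x := by nlinarith
  rcases le_total 0 x with h | h
  · nlinarith [mul_le_mul_of_nonneg_left h4 h]
  · nlinarith [mul_nonneg (sq_nonneg x) hp.le]

/-- Second-order upper bound for `exp`, symmetric in the two base points. -/
theorem exp_le_taylor (a b : ℝ) :
    Real.exp b ≤ Real.exp a + (b - a) * Real.exp a
      + (b - a) ^ 2 * (Real.exp a + Real.exp b) := by
  have h := mul_le_mul_of_nonneg_left (exp_le_quadratic (b - a)) (Real.exp_pos a).le
  have h3 : Real.exp a * Real.exp (b - a) = Real.exp b := by rw [← Real.exp_add]; ring_nf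
  rw [h3] at h
  calc _ ≤ _ := h
    _ = Real.exp a + (b - a) * Real.exp a
      + (b - a) ^ 2 * (Real.exp a + Real.exp a * Real.exp (b - a)) := by ring
    _ = _ := by rw [h3]

/-- Taylor bound for the trace exponential of symmetric operators, with eigenbasis `u` of `A`.
In the eigenbases `u` of `A` and `v` of `B` all four traces are sums over `i, j` with the weights
`⟪u i, v j⟫ ^ 2`, so that the scalar bound can be applied term by term. -/
theorem traceExp_le_taylor {ι : Type*} [Fintype ι] {A B : E →L[ℝ] E}
    (hA : (A : E →ₗ[ℝ] E).IsSymmetric) (hB : (B : E →ₗ[ℝ] E).IsSymmetric)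
    {u : OrthonormalBasis ι ℝ E} {lam : ι → ℝ} (hu : ∀ i, A (u i) = lam i • u i) :
    traceExp B ≤ traceExp A + ∑ i, Real.exp (lam i) * inner ℝ (u i) ((B - A) (u i))
      + ‖B - A‖ ^ 2 * (traceExp A + traceExp B) := by
  obtain ⟨v, mu, hv⟩ := exists_eigenbasis hB
  set p : ι → Fin (Module.finrank ℝ E) → ℝ := fun i j => inner ℝ (u i) (v j) ^ 2 with hp
  have hp1 : ∀ i, ∑ j, p i j = 1 := fun i => by
    rw [v.sum_sq_inner_left, u.norm_eq_one, one_pow]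
  have hp2 : ∀ j, ∑ i, p i j = 1 := fun j => by
    rw [u.sum_sq_inner_right, v.norm_eq_one, one_pow]
  have hX1 : ∀ i j, inner ℝ (u i) ((B - A) (v j)) = (mu j - lam i) * inner ℝ (u i) (v j) := by
    intro i j
    rw [sub_apply, inner_sub_right, inner_eigenbasis_apply hA hu, hv,
      real_inner_smul_right, sub_mul]
  have hX2 : ∀ i j, inner ℝ (v j) ((B - A) (u i)) = (mu j - lam i) * inner ℝ (u i) (v j) := by
    intro i j
    rw [sub_apply, inner_sub_right, inner_eigenbasis_apply hB hv, hu,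
      real_inner_smul_right, sub_mul, real_inner_comm]
  have hlin : ∀ i, inner ℝ (u i) ((B - A) (u i)) = ∑ j, p i j * (mu j - lam i) := by
    intro i
    rw [← v.sum_inner_mul_inner]
    refine Finset.sum_congr rfl fun j _ => ?_
    rw [hX2, hp]; ring
  have hq1 : ∀ i, ∑ j, p i j * (mu j - lam i) ^ 2 ≤ ‖B - A‖ ^ 2 := by
    intro i
    have h : ∑ j, p i j * (mu j - lam i) ^ 2 = ‖(B - A) (u i)‖ ^ 2 := by
      rw [← v.sum_sq_inner_right]
      refine Finset.sum_congr rfl fun j _ => ?_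
      rw [hX2, hp]; ring
    rw [h]
    have := (B - A).le_opNorm (u i)
    rw [u.norm_eq_one, mul_one] at this
    gcongr
  have hq2 : ∀ j, ∑ i, p i j * (mu j - lam i) ^ 2 ≤ ‖B - A‖ ^ 2 := by
    intro j
    have h : ∑ i, p i j * (mu j - lam i) ^ 2 = ‖(B - A) (v j)‖ ^ 2 := by
      rw [← u.sum_sq_inner_right]
      refine Finset.sum_congr rfl fun i _ => ?_
      rw [hX1, hp]; ring
    rw [h]
    have := (B - A).le_opNorm (v j)
    rw [v.norm_eq_one, mul_one] at this
    gcongr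
  have hsc : ∑ i, ∑ j, p i j * Real.exp (mu j) ≤ ∑ i, ∑ j, p i j * (Real.exp (lam i)
      + (mu j - lam i) * Real.exp (lam i)
      + (mu j - lam i) ^ 2 * (Real.exp (lam i) + Real.exp (mu j))) := by
    gcongr with i _ j _
    exact exp_le_taylor _ _
  have e1 : ∑ i, ∑ j, p i j * Real.exp (mu j) = traceExp B := by
    rw [traceExp_eq_sum hv, Finset.sum_comm]
    refine Finset.sum_congr rfl fun j _ => ?_
    rw [← Finset.sum_mul, hp2, one_mul]
  have e2 : ∑ i, ∑ j, p i j * (Real.exp (lam i)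
      + (mu j - lam i) * Real.exp (lam i)
      + (mu j - lam i) ^ 2 * (Real.exp (lam i) + Real.exp (mu j)))
      = traceExp A + ∑ i, Real.exp (lam i) * inner ℝ (u i) ((B - A) (u i))
        + (∑ i, Real.exp (lam i) * ∑ j, p i j * (mu j - lam i) ^ 2
        + ∑ j, Real.exp (mu j) * ∑ i, p i j * (mu j - lam i) ^ 2) := by
    rw [traceExp_eq_sum hu]
    have : ∑ j, Real.exp (mu j) * ∑ i, p i j * (mu j - lam i) ^ 2
        = ∑ i, ∑ j, Real.exp (mu j) * (p i j * (mu j - lam i) ^ 2) := by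
      simp_rw [Finset.mul_sum]
      exact Finset.sum_comm
    rw [this, ← Finset.sum_add_distrib, ← Finset.sum_add_distrib, ← Finset.sum_add_distrib]
    refine Finset.sum_congr rfl fun i _ => ?_
    rw [hlin]
    have h1 : Real.exp (lam i) = ∑ j, p i j * Real.exp (lam i) := by
      rw [← Finset.sum_mul, hp1, one_mul]
    conv_rhs => enter [1, 1]; rw [h1]
    rw [Finset.mul_sum, Finset.mul_sum, ← Finset.sum_add_distrib, ← Finset.sum_add_distrib,
      ← Finset.sum_add_distrib]
    refine Finset.sum_congr rfl fun j _ => ?_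
    ring
  rw [e1, e2] at hsc
  have e3 : ∑ i, Real.exp (lam i) * ∑ j, p i j * (mu j - lam i) ^ 2
      ≤ ‖B - A‖ ^ 2 * traceExp A := by
    rw [traceExp_eq_sum hu, Finset.mul_sum]
    refine Finset.sum_le_sum fun i _ => ?_
    rw [mul_comm]
    gcongr
    exact hq1 i
  have e4 : ∑ j, Real.exp (mu j) * ∑ i, p i j * (mu j - lam i) ^ 2
      ≤ ‖B - A‖ ^ 2 * traceExp B := by
    rw [traceExp_eq_sum hv, Finset.mul_sum]
    refine Finset.sum_le_sum fun i _ => ?_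
    rw [mul_comm]
    gcongr
    exact hq2 i
  linarith

/-- One increment of the trace exponential: a linear term, which averages out for a centered
increment, and a term controlled by the second moment. -/
theorem exists_traceExp_add_le {A : E →L[ℝ] E} (hA : (A : E →ₗ[ℝ] E).IsSymmetric) :
    ∃ Λ : (E →L[ℝ] E) →L[ℝ] ℝ, ∀ X : E →L[ℝ] E, (X : E →ₗ[ℝ] E).IsSymmetric → ‖X‖ ≤ 1 / 2 →
      traceExp (A + X) ≤ traceExp A * (1 + 4 * ‖X‖ ^ 2) + Λ X := by
  obtain ⟨u, lam, hu⟩ := exists_eigenbasis hA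
  refine ⟨∑ i, Real.exp (lam i) •
    (innerSL ℝ (u i)).comp (ContinuousLinearMap.apply ℝ E (u i)), fun X hX hn => ?_⟩
  have hsymm : ((A + X : E →L[ℝ] E) : E →ₗ[ℝ] E).IsSymmetric := by
    rw [ContinuousLinearMap.toLinearMap_add]
    exact hA.add hX
  have h := traceExp_le_taylor hA hsymm hu
  rw [add_sub_cancel_left] at h
  have hΛ : (∑ i, Real.exp (lam i) •
      (innerSL ℝ (u i)).comp (ContinuousLinearMap.apply ℝ E (u i))) X
      = ∑ i, Real.exp (lam i) * inner ℝ (u i) (X (u i)) := by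
    simp
  rw [hΛ]
  set S := ∑ i, Real.exp (lam i) * inner ℝ (u i) (X (u i))
  have hS : S ≤ ‖X‖ * traceExp A := by
    rw [traceExp_eq_sum hu, Finset.mul_sum]
    refine Finset.sum_le_sum fun i _ => ?_
    rw [mul_comm]
    gcongr
    have h1 := real_inner_le_norm (u i) (X (u i))
    have h2 := X.le_opNorm (u i)
    rw [u.norm_eq_one] at h1 h2
    linarith
  have hA0 := traceExp_nonneg hA
  have hB0 := traceExp_nonneg hsymm
  have hsq : ‖X‖ ^ 2 ≤ 1 / 4 := by nlinarith [norm_nonneg X]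
  have hB : traceExp (A + X) ≤ 3 * traceExp A := by nlinarith [norm_nonneg X]
  nlinarith [sq_nonneg ‖X‖]

end Spectral

/-! ### Bernstein inequalities -/

theorem piFinSuccAbove_zero_symm_apply {α : Type*} [MeasurableSpace α] {n : ℕ} (a : α)
    (t : Fin n → α) :
    (MeasurableEquiv.piFinSuccAbove (fun _ : Fin (n + 1) => α) 0).symm (a, t)
      = Fin.cons a t :=
  Fin.insertNth_zero' a t

theorem lintegral_pi_succ {α : Type*} [MeasurableSpace α] (μ : Measure α) [SigmaFinite μ] {n : ℕ}
    {F : (Fin (n + 1) → α) → ENNReal} (hF : Measurable F) :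
    ∫⁻ s, F s ∂(Measure.pi fun _ => μ)
      = ∫⁻ a, ∫⁻ t, F (Fin.cons a t) ∂(Measure.pi fun _ => μ) ∂μ := by
  have h := (measurePreserving_piFinSuccAbove (fun _ : Fin (n + 1) => μ) 0).symm
  rw [← h.lintegral_comp hF, lintegral_prod]
  · refine lintegral_congr fun a => lintegral_congr fun t => ?_
    rw [piFinSuccAbove_zero_symm_apply]
  · exact (hF.comp h.measurable).aemeasurable

theorem measurable_cons {α : Type*} [MeasurableSpace α] {n : ℕ} :
    Measurable fun p : α × (Fin n → α) => (Fin.cons p.1 p.2 : Fin (n + 1) → α) := by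
  refine measurable_pi_iff.2 fun i => ?_
  refine Fin.cases ?_ (fun j => ?_) i
  · simpa using measurable_fst
  · simp only [Fin.cons_succ]
    exact (measurable_pi_apply j).comp measurable_snd

section Concentration

variable {d : ℕ} {Ξ : Type*} [MeasurableSpace Ξ] {D : Measure Ξ} [IsProbabilityMeasure D]

/-- Averaging over one centered increment multiplies the trace exponential by at most
`1 + 4 v`, where `v` bounds the second moment of the increment. -/
theorem lintegral_traceExp_add_le {A : Vec d →L[ℝ] Vec d} {Y : Ξ → Vec d →L[ℝ] Vec d} {v : ℝ}
    (hA : (A : Vec d →ₗ[ℝ] Vec d).IsSymmetric)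
    (hYm : Measurable Y) (hY : ∀ ξ, (Y ξ : Vec d →ₗ[ℝ] Vec d).IsSymmetric)
    (h0 : ∫ ξ, Y ξ ∂D = 0) (hb : ∀ᵐ ξ ∂D, ‖Y ξ‖ ≤ 1 / 2) (hv : ∫ ξ, ‖Y ξ‖ ^ 2 ∂D ≤ v) :
    ∫⁻ ξ, ENNReal.ofReal (traceExp (A + Y ξ)) ∂D ≤ ENNReal.ofReal (traceExp A * (1 + 4 * v)) := by
  obtain ⟨Λ, hΛ⟩ := exists_traceExp_add_le hA
  have hYi : Integrable Y D := Integrable.of_bound hYm.aestronglyMeasurable _ hb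
  have hY2 : Integrable (fun ξ => ‖Y ξ‖ ^ 2) D := by
    refine Integrable.of_bound (hYm.norm.pow_const 2).aestronglyMeasurable (1 / 4) ?_
    filter_upwards [hb] with ξ hξ
    rw [Real.norm_of_nonneg (by positivity)]
    nlinarith [norm_nonneg (Y ξ)]
  have hi1 : Integrable (fun ξ => traceExp A * (1 + 4 * ‖Y ξ‖ ^ 2)) D :=
    ((integrable_const 1).add (hY2.const_mul 4)).const_mul _
  have hi2 : Integrable (fun ξ => Λ (Y ξ)) D := Λ.integrable_comp hYi
  have hpt : ∀ᵐ ξ ∂D, traceExp (A + Y ξ) ≤ traceExp A * (1 + 4 * ‖Y ξ‖ ^ 2) + Λ (Y ξ) := by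
    filter_upwards [hb] with ξ hξ using hΛ _ (hY ξ) hξ
  have hnn : ∀ ξ, 0 ≤ traceExp (A + Y ξ) := fun ξ => by
    refine traceExp_nonneg ?_
    rw [ContinuousLinearMap.toLinearMap_add]
    exact hA.add (hY ξ)
  calc ∫⁻ ξ, ENNReal.ofReal (traceExp (A + Y ξ)) ∂D
      ≤ ∫⁻ ξ, ENNReal.ofReal (traceExp A * (1 + 4 * ‖Y ξ‖ ^ 2) + Λ (Y ξ)) ∂D := by
        refine lintegral_mono_ae ?_
        filter_upwards [hpt] with ξ hξ using ENNReal.ofReal_le_ofReal hξ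
    _ = ENNReal.ofReal (∫ ξ, (traceExp A * (1 + 4 * ‖Y ξ‖ ^ 2) + Λ (Y ξ)) ∂D) := by
        refine (ofReal_integral_eq_lintegral_ofReal (hi1.add hi2) ?_).symm
        filter_upwards [hpt] with ξ hξ using (hnn ξ).trans hξ
    _ ≤ _ := by
        refine ENNReal.ofReal_le_ofReal ?_
        rw [integral_add hi1 hi2, Λ.integral_comp_comm hYi, h0, map_zero, add_zero,
          integral_const_mul, integral_add (integrable_const 1) (hY2.const_mul 4),
          integral_const_mul]
        simp only [integral_const, probReal_univ, smul_eq_mul, mul_one]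
        have := traceExp_nonneg hA
        gcongr

theorem lintegral_traceExp_add_sum_le {Y : Ξ → Vec d →L[ℝ] Vec d} {v : ℝ}
    (hYm : Measurable Y) (hY : ∀ ξ, (Y ξ : Vec d →ₗ[ℝ] Vec d).IsSymmetric)
    (h0 : ∫ ξ, Y ξ ∂D = 0) (hb : ∀ᵐ ξ ∂D, ‖Y ξ‖ ≤ 1 / 2) (hv : ∫ ξ, ‖Y ξ‖ ^ 2 ∂D ≤ v) (n : ℕ) :
    ∀ A : Vec d →L[ℝ] Vec d, (A : Vec d →ₗ[ℝ] Vec d).IsSymmetric →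
      ∫⁻ s, ENNReal.ofReal (traceExp (A + ∑ i, Y (s i))) ∂(Measure.pi fun _ : Fin n => D)
        ≤ ENNReal.ofReal (traceExp A * (1 + 4 * v) ^ n) := by
  have hv0 : 0 ≤ v := le_trans (integral_nonneg fun ξ => by positivity) hv
  have hcont : Measurable (traceExp : (Vec d →L[ℝ] Vec d) → ℝ) := continuous_traceExp.measurable
  induction n with
  | zero => intro A hA; simp
  | succ n ih =>
    intro A hA
    rw [lintegral_pi_succ D]
    · calc _ ≤ ∫⁻ ξ, ENNReal.ofReal (traceExp (A + Y ξ) * (1 + 4 * v) ^ n) ∂D := by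
            refine lintegral_mono fun ξ => ?_
            refine le_of_eq_of_le ?_ (ih (A + Y ξ) ?_)
            · simp only [Fin.sum_univ_succ, Fin.cons_zero, Fin.cons_succ, add_assoc]
            · rw [ContinuousLinearMap.toLinearMap_add]
              exact hA.add (hY ξ)
        _ = (∫⁻ ξ, ENNReal.ofReal (traceExp (A + Y ξ)) ∂D)
              * ENNReal.ofReal ((1 + 4 * v) ^ n) := by
            rw [← lintegral_mul_const]
            · refine lintegral_congr fun ξ => ?_
              rw [ENNReal.ofReal_mul' (by positivity)]
            · exact (hcont.comp (measurable_const.add hYm)).ennreal_ofReal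
        _ ≤ ENNReal.ofReal (traceExp A * (1 + 4 * v)) * ENNReal.ofReal ((1 + 4 * v) ^ n) := by
            gcongr
            exact lintegral_traceExp_add_le hA hYm hY h0 hb hv
        _ = _ := by
            rw [← ENNReal.ofReal_mul' (by positivity), pow_succ]
            ring_nf
    · refine (hcont.comp (measurable_const.add ?_)).ennreal_ofReal
      exact Finset.measurable_fun_sum _ fun i _ => hYm.comp (measurable_pi_apply i)

/-- The largest eigenvalue in absolute value contributes to one of the two traces. -/
theorem exp_norm_le_traceExp {A : Vec d →L[ℝ] Vec d} {b : ℝ} (hb : 0 ≤ b)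
    (hA : (A : Vec d →ₗ[ℝ] Vec d).IsSymmetric) (h : b < ‖A‖) :
    Real.exp b ≤ traceExp A + traceExp (-A) := by
  obtain ⟨u, lam, hu⟩ := exists_eigenbasis hA
  have hu' : ∀ i, (-A) (u i) = (-lam i) • u i := fun i => by
    rw [neg_apply, hu, neg_smul]
  obtain ⟨i, hi⟩ : ∃ i, b < |lam i| := by
    by_contra! hcon
    exact absurd (norm_le_of_eigenvalues hA hu hb hcon) (not_le.2 h)
  rw [traceExp_eq_sum hu, traceExp_eq_sum hu', ← Finset.sum_add_distrib]
  refine le_trans ?_ (Finset.single_le_sum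
    (f := fun i => Real.exp (lam i) + Real.exp (-lam i)) (fun j _ => by positivity)
    (Finset.mem_univ i))
  have h1 := Real.exp_pos (lam i)
  have h2 := Real.exp_pos (-lam i)
  rcases lt_abs.1 hi with h | h
  · linarith [Real.exp_le_exp.2 h.le]
  · linarith [Real.exp_le_exp.2 h.le]

/-- Bernstein inequality for averages of independent centered symmetric random operators,
with the second moment of the operator norm in the role of the matrix variance. -/
theorem measure_norm_average_gt_le {Y : Ξ → Vec d →L[ℝ] Vec d} {M σ t Λ : ℝ} {n : ℕ}
    (hYm : Measurable Y) (hY : ∀ ξ, (Y ξ : Vec d →ₗ[ℝ] Vec d).IsSymmetric)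
    (h0 : ∫ ξ, Y ξ ∂D = 0) (hb : ∀ᵐ ξ ∂D, ‖Y ξ‖ ≤ M) (hv : ∫ ξ, ‖Y ξ‖ ^ 2 ∂D ≤ σ ^ 2)
    (hn : 0 < n) (ht : 0 < t) (hΛ : 0 < Λ) (hM : 4 * Λ * M ≤ n * t)
    (hσ : 16 * Λ * σ ^ 2 ≤ n * t ^ 2) :
    (Measure.pi fun _ : Fin n => D) {s | t < ‖(1 / (n : ℝ)) • ∑ i, Y (s i)‖}
      ≤ ENNReal.ofReal (2 * d * Real.exp (-Λ)) := by
  have hn' : (0 : ℝ) < n := by exact_mod_cast hn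
  have hcont : Measurable (traceExp : (Vec d →L[ℝ] Vec d) → ℝ) := continuous_traceExp.measurable
  -- The exponent `θ` for which `θ n t = 2 Λ` is small enough for the increments `θ Y`.
  set θ : ℝ := 2 * Λ / (n * t) with hθ
  have hθ0 : 0 < θ := by positivity
  have hθt : θ * (n * t) = 2 * Λ := by rw [hθ]; field_simp
  have hθM : θ * M ≤ 1 / 2 := by
    have : θ * M * (4 * Λ) ≤ 1 / 2 * (4 * Λ) := by
      calc θ * M * (4 * Λ) = θ * (4 * Λ * M) := by ring
        _ ≤ θ * (n * t) := by gcongr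
        _ = _ := by rw [hθt]; ring
    exact le_of_mul_le_mul_right this (by positivity)
  have hθσ : n * (4 * (θ ^ 2 * σ ^ 2)) ≤ Λ := by
    have : n * (4 * (θ ^ 2 * σ ^ 2)) * (4 * Λ) ≤ Λ * (4 * Λ) := by
      calc n * (4 * (θ ^ 2 * σ ^ 2)) * (4 * Λ) = n * θ ^ 2 * (16 * Λ * σ ^ 2) := by ring
        _ ≤ n * θ ^ 2 * (n * t ^ 2) := by gcongr
        _ = (θ * (n * t)) ^ 2 := by ring
        _ = _ := by rw [hθt]; ring
    exact le_of_mul_le_mul_right this (by positivity)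
  -- The Laplace bound for either sign of the exponent.
  have key : ∀ ς : ℝ, |ς| = θ →
      ∫⁻ s, ENNReal.ofReal (traceExp (∑ i, ς • Y (s i))) ∂(Measure.pi fun _ : Fin n => D)
        ≤ ENNReal.ofReal (d * Real.exp Λ) := by
    intro ς hς
    have hς2 : ς ^ 2 = θ ^ 2 := by rw [← hς, sq_abs]
    have h := lintegral_traceExp_add_sum_le (D := D) (Y := fun ξ => ς • Y ξ)
      (v := θ ^ 2 * σ ^ 2) (hYm.const_smul ς)
      (fun ξ => by
        rw [ContinuousLinearMap.toLinearMap_smul]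
        exact (hY ξ).smul (by simp))
      (by rw [integral_smul, h0, smul_zero])
      (by
        filter_upwards [hb] with ξ hξ
        rw [norm_smul, Real.norm_eq_abs, hς]
        exact le_trans (by gcongr) hθM)
      (by
        simp_rw [norm_smul, Real.norm_eq_abs, hς, mul_pow]
        rw [integral_const_mul]
        gcongr) n 0 (by intro x y; simp)
    simp only [zero_add] at h
    refine h.trans (ENNReal.ofReal_le_ofReal ?_)
    rw [traceExp_zero, finrank_euclideanSpace_fin]
    gcongr
    calc (1 + 4 * (θ ^ 2 * σ ^ 2)) ^ n ≤ (Real.exp (4 * (θ ^ 2 * σ ^ 2))) ^ n := by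
          gcongr
          linarith [Real.add_one_le_exp (4 * (θ ^ 2 * σ ^ 2))]
      _ = Real.exp (n * (4 * (θ ^ 2 * σ ^ 2))) := by rw [← Real.exp_nat_mul]
      _ ≤ _ := Real.exp_le_exp.2 hθσ
  have hsum : ∀ ς : ℝ, Measurable fun s : Fin n → Ξ => ∑ i, ς • Y (s i) := fun ς =>
    Finset.measurable_fun_sum _ fun i _ => (hYm.comp (measurable_pi_apply i)).const_smul ς
  have hms : ∀ ς : ℝ, Measurable fun s : Fin n → Ξ =>
      ENNReal.ofReal (traceExp (∑ i, ς • Y (s i))) := fun ς =>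
    (hcont.comp (hsum ς)).ennreal_ofReal
  have hsym : ∀ (ς : ℝ) (s : Fin n → Ξ),
      ((∑ i, ς • Y (s i) : Vec d →L[ℝ] Vec d) : Vec d →ₗ[ℝ] Vec d).IsSymmetric := by
    intro ς s x y
    have h' := fun i => hY (s i) x y
    simp only [ContinuousLinearMap.coe_coe] at h'
    simp [sum_inner, inner_sum, inner_smul_left, inner_smul_right, h']
  have hsub : {s : Fin n → Ξ | t < ‖(1 / (n : ℝ)) • ∑ i, Y (s i)‖} ⊆
      {s | ENNReal.ofReal (Real.exp (2 * Λ)) ≤ ENNReal.ofReal (traceExp (∑ i, θ • Y (s i)))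
        + ENNReal.ofReal (traceExp (∑ i, (-θ) • Y (s i)))} := by
    intro s hs
    simp only [Set.mem_ofPred_eq] at hs ⊢
    rw [← ENNReal.ofReal_add (traceExp_nonneg (hsym _ _)) (traceExp_nonneg (hsym _ _))]
    refine ENNReal.ofReal_le_ofReal ?_
    have hneg : ∑ i, (-θ) • Y (s i) = -∑ i, θ • Y (s i) := by
      rw [← Finset.smul_sum, ← Finset.smul_sum, neg_smul]
    rw [hneg]
    refine exp_norm_le_traceExp (by positivity) (hsym _ _) ?_
    rw [← Finset.smul_sum, norm_smul, Real.norm_of_nonneg hθ0.le, ← hθt]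
    rw [norm_smul, Real.norm_of_nonneg (by positivity)] at hs
    gcongr
    calc (n : ℝ) * t < n * (1 / n * ‖∑ i, Y (s i)‖) := by gcongr
      _ = _ := by field_simp
  have hmarkov := mul_meas_ge_le_lintegral₀ (μ := Measure.pi fun _ : Fin n => D)
    ((hms θ).add (hms (-θ))).aemeasurable (ENNReal.ofReal (Real.exp (2 * Λ)))
  have hint : ∫⁻ s, (ENNReal.ofReal (traceExp (∑ i, θ • Y (s i)))
        + ENNReal.ofReal (traceExp (∑ i, (-θ) • Y (s i)))) ∂(Measure.pi fun _ : Fin n => D)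
      ≤ ENNReal.ofReal (2 * d * Real.exp Λ) := by
    rw [lintegral_add_left (hms θ)]
    calc _ ≤ ENNReal.ofReal (d * Real.exp Λ) + ENNReal.ofReal (d * Real.exp Λ) :=
          add_le_add (key θ (abs_of_pos hθ0)) (key (-θ) (by rw [abs_neg, abs_of_pos hθ0]))
      _ = _ := by
          rw [← ENNReal.ofReal_add (by positivity) (by positivity)]
          ring_nf
  refine (measure_mono hsub).trans ?_
  have h2 := hmarkov.trans hint
  have hpos : ENNReal.ofReal (Real.exp (2 * Λ)) ≠ 0 := by simp [Real.exp_pos]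
  rw [mul_comm, ← ENNReal.le_div_iff_mul_le (Or.inl hpos) (Or.inl ENNReal.ofReal_ne_top)] at h2
  refine h2.trans (le_of_eq ?_)
  rw [← ENNReal.ofReal_div_of_pos (Real.exp_pos _)]
  congr 1
  rw [mul_div_assoc, ← Real.exp_sub]
  ring_nf

/-- The symmetric operator `v ⊗ e + e ⊗ v`. -/
def symTensor (e v : Vec d) : Vec d →L[ℝ] Vec d :=
  (innerSL ℝ e).smulRight v + (innerSL ℝ v).smulRight e

theorem symTensor_apply (e v x : Vec d) :
    symTensor e v x = inner ℝ e x • v + inner ℝ v x • e := rfl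

theorem isSymmetric_symTensor (e v : Vec d) :
    (symTensor e v : Vec d →ₗ[ℝ] Vec d).IsSymmetric := by
  intro x y
  simp only [ContinuousLinearMap.coe_coe, symTensor_apply, inner_add_left, real_inner_smul_left,
    real_inner_comm _ x]
  ring

theorem norm_symTensor_le {e : Vec d} (he : ‖e‖ = 1) (v : Vec d) : ‖symTensor e v‖ ≤ 2 * ‖v‖ := by
  refine ContinuousLinearMap.opNorm_le_bound _ (by positivity) fun x => ?_
  rw [symTensor_apply]
  refine (norm_add_le _ _).trans ?_
  rw [norm_smul, norm_smul, he]
  have h1 := norm_inner_le_norm (𝕜 := ℝ) e x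
  have h2 := norm_inner_le_norm (𝕜 := ℝ) v x
  rw [he] at h1
  nlinarith [norm_nonneg v]

/-- Evaluation at `e` shows that the embedding does not shrink norms. -/
theorem le_norm_symTensor {e : Vec d} (he : ‖e‖ = 1) (v : Vec d) : ‖v‖ ≤ ‖symTensor e v‖ := by
  have h := (symTensor e v).le_opNorm e
  rw [he, mul_one] at h
  refine le_trans ?_ h
  refine abs_le_of_sq_le_sq' ?_ (norm_nonneg _) |>.2
  rw [symTensor_apply, real_inner_self_eq_norm_sq, he, one_pow, one_smul, norm_add_sq_real,
    norm_smul, he, real_inner_smul_right, Real.norm_eq_abs, mul_one, sq_abs]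
  nlinarith [sq_nonneg (inner ℝ v e)]

theorem exists_symTensor_clm (e : Vec d) :
    ∃ J : Vec d →L[ℝ] (Vec d →L[ℝ] Vec d), ∀ v, J v = symTensor e v := by
  let J : Vec d →ₗ[ℝ] (Vec d →L[ℝ] Vec d) :=
    { toFun := symTensor e
      map_add' := fun v w => by
        ext1 x
        simp only [symTensor_apply, add_apply, inner_add_left]
        module
      map_smul' := fun a v => by
        ext1 x
        simp only [symTensor_apply, smul_apply, real_inner_smul_left, RingHom.id_apply]
        module }
  exact ⟨LinearMap.toContinuousLinearMap J, fun v => rfl⟩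

/-- Bernstein inequality for averages of independent centered random vectors, obtained from the
one for operators by embedding `v` as `v ⊗ e + e ⊗ v` for a unit vector `e`. -/
theorem measure_norm_average_vec_gt_le {Y : Ξ → Vec d} {M σ t Λ : ℝ} {n : ℕ} (hd : 0 < d)
    (hYm : Measurable Y) (h0 : ∫ ξ, Y ξ ∂D = 0) (hb : ∀ᵐ ξ ∂D, ‖Y ξ‖ ≤ M)
    (hv : ∫ ξ, ‖Y ξ‖ ^ 2 ∂D ≤ σ ^ 2)
    (hn : 0 < n) (ht : 0 < t) (hΛ : 0 < Λ) (hM : 8 * Λ * M ≤ n * t)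
    (hσ : 64 * Λ * σ ^ 2 ≤ n * t ^ 2) :
    (Measure.pi fun _ : Fin n => D) {s | t < ‖(1 / (n : ℝ)) • ∑ i, Y (s i)‖}
      ≤ ENNReal.ofReal (2 * d * Real.exp (-Λ)) := by
  set e : Vec d := EuclideanSpace.single ⟨0, hd⟩ 1 with he_def
  have he : ‖e‖ = 1 := by simp [he_def]
  obtain ⟨J, hJ⟩ := exists_symTensor_clm e
  have hYi : Integrable Y D := Integrable.of_bound hYm.aestronglyMeasurable _ hb
  have hY2 : Integrable (fun ξ => ‖Y ξ‖ ^ 2) D := by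
    refine Integrable.of_bound (hYm.norm.pow_const 2).aestronglyMeasurable (M ^ 2) ?_
    filter_upwards [hb] with ξ hξ
    rw [Real.norm_of_nonneg (by positivity)]
    gcongr
  have hJm : Measurable fun ξ => J (Y ξ) := J.continuous.measurable.comp hYm
  have h := measure_norm_average_gt_le (D := D) (Y := fun ξ => J (Y ξ)) (M := 2 * M)
    (σ := 2 * σ) (t := t) (Λ := Λ) (n := n) hJm
    (fun ξ => by rw [hJ]; exact isSymmetric_symTensor _ _)
    (by rw [J.integral_comp_comm hYi, h0, map_zero])
    (by
      filter_upwards [hb] with ξ hξ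
      rw [hJ]
      exact (norm_symTensor_le he _).trans (by gcongr))
    (by
      calc ∫ ξ, ‖J (Y ξ)‖ ^ 2 ∂D ≤ ∫ ξ, 2 ^ 2 * ‖Y ξ‖ ^ 2 ∂D := by
            refine integral_mono_of_nonneg (ae_of_all _ fun ξ => by positivity)
              (hY2.const_mul _) (ae_of_all _ fun ξ => ?_)
            simp only
            rw [hJ, ← mul_pow]
            gcongr
            exact norm_symTensor_le he _
        _ ≤ _ := by
            rw [integral_const_mul, mul_pow]
            gcongr)
    hn ht hΛ (by linarith) (by nlinarith)
  refine (measure_mono fun s hs => ?_).trans h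
  simp only [Set.mem_ofPred_eq] at hs ⊢
  rw [← map_sum, ← map_smul, hJ]
  exact hs.trans_le (le_norm_symTensor he _)

end Concentration

/-! ### The cubic model and gradient descent on it -/

section CubicModel

variable {d : ℕ} {ρ : ℝ} {g : Vec d} {B : Vec d →L[ℝ] Vec d}

/-- Exact second-order expansion of the cubic model. -/
theorem cubicModel_add (hB : (B : Vec d →ₗ[ℝ] Vec d).IsSymmetric) (x w : Vec d) :
    cubicModel ρ g B (x + w) = cubicModel ρ g B x + inner ℝ w (cubicModelGrad ρ g B x)
      + 1 / 2 * inner ℝ w (B w)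
      + ρ / 12 * ((‖x + w‖ - ‖x‖) ^ 2 * (2 * ‖x + w‖ + ‖x‖)) + ρ / 4 * ‖x‖ * ‖w‖ ^ 2 := by
  have hs : inner ℝ x (B w) = inner ℝ w (B x) := by
    have := hB x w
    simp only [ContinuousLinearMap.coe_coe] at this
    rw [← this, real_inner_comm]
  have hn := norm_add_sq_real x w
  have hc : inner ℝ w x = inner ℝ x w := real_inner_comm _ _
  unfold cubicModel cubicModelGrad
  simp only [map_add, inner_add_left, inner_add_right, real_inner_smul_right, hs, hc]
  linear_combination (ρ / 4 * ‖x‖) * hn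

theorem cubicModel_add_le (hρ : 0 ≤ ρ) (hB : (B : Vec d →ₗ[ℝ] Vec d).IsSymmetric) (x w : Vec d) :
    cubicModel ρ g B (x + w) ≤ cubicModel ρ g B x + inner ℝ w (cubicModelGrad ρ g B x)
      + (1 / 2 * ‖B‖ + ρ / 6 * ‖x + w‖ + ρ / 3 * ‖x‖) * ‖w‖ ^ 2 := by
  rw [cubicModel_add hB]
  have h1 : (‖x + w‖ - ‖x‖) ^ 2 ≤ ‖w‖ ^ 2 := by
    have := abs_norm_sub_norm_le (x + w) x
    rw [add_sub_cancel_left] at this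
    rw [← sq_abs]
    gcongr
  have h2 : inner ℝ w (B w) ≤ ‖B‖ * ‖w‖ ^ 2 := by
    have h3 := real_inner_le_norm w (B w)
    have h4 := B.le_opNorm w
    nlinarith [norm_nonneg w]
  have h3 := mul_le_mul_of_nonneg_right h1
    (by positivity : 0 ≤ ρ / 12 * (2 * ‖x + w‖ + ‖x‖))
  nlinarith

theorem cubicModelGrad_eq_zero (hρ : 0 ≤ ρ) (hB : (B : Vec d →ₗ[ℝ] Vec d).IsSymmetric) {s : Vec d}
    (hs : ∀ v, cubicModel ρ g B s ≤ cubicModel ρ g B v) : cubicModelGrad ρ g B s = 0 := by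
  set G := cubicModelGrad ρ g B s with hG
  by_contra hne
  have hpos : 0 < ‖G‖ := norm_pos_iff.2 hne
  set Q := 1 / 2 * ‖B‖ + ρ / 6 * (‖s‖ + ‖G‖) + ρ / 3 * ‖s‖ with hQ
  have hQ0 : 0 ≤ Q := by positivity
  -- A step `-t G` with `t ≤ 1` and `t Q < 1` would decrease the model.
  set t := 1 / (Q + 1) with ht
  have ht0 : 0 < t := by positivity
  have ht1 : t * (Q + 1) = 1 := by rw [ht]; field_simp
  have hle1 : t ≤ 1 := by nlinarith
  have h := (hs (s + -(t • G))).trans (cubicModel_add_le hρ hB s (-(t • G)))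
  have hn : ‖-(t • G)‖ = t * ‖G‖ := by rw [norm_neg, norm_smul, Real.norm_of_nonneg ht0.le]
  have hb : ‖s + -(t • G)‖ ≤ ‖s‖ + ‖G‖ := by
    refine (norm_add_le _ _).trans ?_
    rw [hn]
    nlinarith
  rw [← hG, inner_neg_left, real_inner_smul_left, real_inner_self_eq_norm_sq, hn] at h
  have h1 : (1 / 2 * ‖B‖ + ρ / 6 * ‖s + -(t • G)‖ + ρ / 3 * ‖s‖) * (t * ‖G‖) ^ 2
      ≤ Q * (t * ‖G‖) ^ 2 := by
    rw [hQ]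
    gcongr
  have h2 : t * ‖G‖ ^ 2 ≤ Q * (t * ‖G‖) ^ 2 := by linarith
  have h3 : 0 < t * ‖G‖ ^ 2 := by positivity
  have h4 : Q * (t * ‖G‖) ^ 2 = (t * Q) * (t * ‖G‖ ^ 2) := by ring
  nlinarith

/-- Second-order optimality of a global minimizer `s` of the cubic model:
`B + (ρ / 2) ‖s‖ I` has no negative eigenvalue. -/
theorem eigenvalue_add_nonneg (hρ : 0 ≤ ρ) (hB : (B : Vec d →ₗ[ℝ] Vec d).IsSymmetric) {s : Vec d}
    (hs : ∀ v, cubicModel ρ g B s ≤ cubicModel ρ g B v) {u : Vec d} {lam : ℝ} (hu1 : ‖u‖ = 1)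
    (hu : B u = lam • u) : 0 ≤ lam + ρ / 2 * ‖s‖ := by
  have hG := cubicModelGrad_eq_zero hρ hB hs
  have key : ∀ t : ℝ, 0 ≤ 1 / 2 * t ^ 2 * (lam + ρ / 2 * ‖s‖)
      + ρ / 12 * ((‖s + t • u‖ - ‖s‖) ^ 2 * (2 * ‖s + t • u‖ + ‖s‖)) := by
    intro t
    have h := hs (s + t • u)
    rw [cubicModel_add hB, hG, inner_zero_right, map_smul, hu, real_inner_smul_left,
      real_inner_smul_right, real_inner_smul_right, real_inner_self_eq_norm_sq, hu1, norm_smul,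
      hu1, Real.norm_eq_abs, mul_one, sq_abs] at h
    linarith
  have hb : ∀ t : ℝ, ‖s + t • u‖ ^ 2 = ‖s‖ ^ 2 + 2 * t * inner ℝ s u + t ^ 2 := by
    intro t
    rw [norm_add_sq_real, norm_smul, hu1, real_inner_smul_right, Real.norm_eq_abs, mul_one, sq_abs]
    ring
  by_cases hsu : inner ℝ s u = 0
  · -- Along `u ⟂ s` the cubic terms are of third order in the step length.
    have h3 : ∀ t : ℝ, 0 < t → -(ρ / 3 * t) ≤ lam + ρ / 2 * ‖s‖ := by
      intro t ht
      have h1 := hb t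
      rw [hsu, mul_zero, add_zero] at h1
      set b := ‖s + t • u‖ with hbdef
      have hb0 : 0 ≤ b := norm_nonneg _
      have hR := norm_nonneg s
      have hbR : ‖s‖ ≤ b := by nlinarith
      have hbt : b ≤ ‖s‖ + t := by nlinarith
      have h2 : (b - ‖s‖) ^ 2 * (2 * b + ‖s‖) ≤ 2 * t ^ 3 := by
        calc (b - ‖s‖) ^ 2 * (2 * b + ‖s‖) ≤ (b - ‖s‖) ^ 2 * (2 * (b + ‖s‖)) := by
              gcongr; linarith
          _ = 2 * (b - ‖s‖) * (b ^ 2 - ‖s‖ ^ 2) := by ring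
          _ = 2 * (b - ‖s‖) * t ^ 2 := by rw [h1]; ring
          _ ≤ 2 * t * t ^ 2 := by gcongr; linarith
          _ = _ := by ring
      have h3 := key t
      have h4 : ρ / 12 * ((b - ‖s‖) ^ 2 * (2 * b + ‖s‖)) ≤ ρ / 12 * (2 * t ^ 3) := by gcongr
      have h5 : 0 ≤ t ^ 2 * (lam + ρ / 2 * ‖s‖ + ρ / 3 * t) := by nlinarith
      have h6 := nonneg_of_mul_nonneg_right h5 (by positivity)
      linarith
    by_contra! hneg
    have h7 := h3 (-(lam + ρ / 2 * ‖s‖) / (ρ + 1)) (by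
      apply div_pos <;> linarith)
    have h8 : ρ / 3 * (-(lam + ρ / 2 * ‖s‖) / (ρ + 1)) < -(lam + ρ / 2 * ‖s‖) := by
      rw [mul_div_assoc', div_lt_iff₀ (by linarith)]
      nlinarith
    linarith
  · -- The reflection of `s` in the direction `u` has the same norm as `s`.
    have h1 := hb (-2 * inner ℝ s u)
    have h2 : ‖s + (-2 * inner ℝ s u) • u‖ = ‖s‖ := by
      rw [← sq_eq_sq₀ (norm_nonneg _) (norm_nonneg _), h1]
      ring
    have h3 := key (-2 * inner ℝ s u)
    rw [h2, sub_self] at h3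
    have h4 : 0 < 1 / 2 * (-2 * inner ℝ s u) ^ 2 := by positivity
    refine nonneg_of_mul_nonneg_right (a := 1 / 2 * (-2 * inner ℝ s u) ^ 2) ?_ h4
    linarith

theorem neg_norm_le_inner_of_isMin (hρ : 0 ≤ ρ) (hB : (B : Vec d →ₗ[ℝ] Vec d).IsSymmetric)
    {s : Vec d} (hs : ∀ v, cubicModel ρ g B s ≤ cubicModel ρ g B v) (v : Vec d) :
    -(ρ / 2 * ‖s‖) * ‖v‖ ^ 2 ≤ inner ℝ v (B v) := by
  obtain ⟨u, lam, hu⟩ := exists_eigenbasis hB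
  rw [← u.sum_inner_mul_inner, ← u.sum_sq_inner_right, Finset.mul_sum]
  refine Finset.sum_le_sum fun i _ => ?_
  rw [inner_eigenbasis_apply hB hu, real_inner_comm]
  have := eigenvalue_add_nonneg hρ hB hs (u.norm_eq_one i) (hu i)
  nlinarith [sq_nonneg (inner ℝ (u i) v)]

theorem cubicModel_isMin_eq (hρ : 0 ≤ ρ) (hB : (B : Vec d →ₗ[ℝ] Vec d).IsSymmetric) {s : Vec d}
    (hs : ∀ v, cubicModel ρ g B s ≤ cubicModel ρ g B v) :
    cubicModel ρ g B s = -(1 / 2 * inner ℝ s (B s)) - ρ / 3 * ‖s‖ ^ 3 := by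
  have hG := cubicModelGrad_eq_zero hρ hB hs
  have h : inner ℝ s (cubicModelGrad ρ g B s) = 0 := by rw [hG, inner_zero_right]
  unfold cubicModelGrad at h
  rw [inner_add_right, inner_add_right, real_inner_smul_right, real_inner_self_eq_norm_sq] at h
  unfold cubicModel
  linarith

/-- The decrease of the cubic model at a global minimizer. -/
theorem cubicModel_isMin_le (hρ : 0 ≤ ρ) (hB : (B : Vec d →ₗ[ℝ] Vec d).IsSymmetric) {s : Vec d}
    (hs : ∀ v, cubicModel ρ g B s ≤ cubicModel ρ g B v) :
    cubicModel ρ g B s ≤ -(1 / 12 * (ρ * ‖s‖ ^ 3)) := by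
  rw [cubicModel_isMin_eq hρ hB hs]
  have := neg_norm_le_inner_of_isMin hρ hB hs s
  nlinarith

end CubicModel

section GradientDescent

variable {d : ℕ} {ρ : ℝ} {g : Vec d} {B : Vec d →L[ℝ] Vec d}

/-- An invariant of gradient descent on the cubic model: in an eigenbasis `u` with shifted
eigenvalues `p`, the point `x` has the coordinates of `s` scaled by nonnegative factors `θ`, where
a factor `θ j` that belongs to a larger eigenvalue than `θ i` is at least `min (θ i) 1`; and
`‖x‖ ≤ ‖s‖`. -/
structure IsScaled {ι : Type*} [Fintype ι] (u : OrthonormalBasis ι ℝ (Vec d)) (p : ι → ℝ)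
    (s x : Vec d) (θ : ι → ℝ) : Prop where
  coord : ∀ i, inner ℝ (u i) x = θ i * inner ℝ (u i) s
  nonneg : ∀ i, 0 ≤ θ i
  ordered : ∀ i j, p i ≤ p j → min (θ i) 1 ≤ θ j
  norm_le : ‖x‖ ≤ ‖s‖

/-- The factors that exceed `1` belong to the largest eigenvalues. -/
theorem IsScaled.exists_threshold {ι : Type*} [Fintype ι] {u : OrthonormalBasis ι ℝ (Vec d)}
    {p θ : ι → ℝ} {s x : Vec d} (H : IsScaled u p s x θ) {q : ℝ} (hp : ∀ i, 0 ≤ p i)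
    (hq : ∀ i, p i ≤ q) (hq0 : 0 ≤ q) :
    ∃ w, 0 ≤ w ∧ w ≤ q ∧ ∀ i, 0 ≤ (p i - w) * (θ i - 1) := by
  classical
  by_cases hne : (Finset.univ.filter fun i => 1 ≤ θ i).Nonempty
  · obtain ⟨i₀, hi₀, hmin⟩ := Finset.exists_min_image _ p hne
    simp only [Finset.mem_filter, Finset.mem_univ, true_and] at hi₀ hmin
    refine ⟨p i₀, hp _, hq _, fun i => ?_⟩
    by_cases hi : 1 ≤ θ i
    · exact mul_nonneg (sub_nonneg.2 (hmin i hi)) (sub_nonneg.2 hi)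
    · refine mul_nonneg_of_nonpos_of_nonpos ?_ (by linarith)
      by_contra! hlt
      have := H.ordered i₀ i (by linarith)
      rw [min_eq_right hi₀] at this
      exact hi this
  · refine ⟨q, hq0, le_rfl, fun i => ?_⟩
    have hi : ¬ 1 ≤ θ i := fun h => hne ⟨i, by simpa using h⟩
    exact mul_nonneg_of_nonpos_of_nonpos (by linarith [hq i]) (by linarith)

/-- A gradient step preserves the invariant. For the norm, the step with the eigenvalues `p i`
replaced by their common threshold dominates the actual step coordinate by coordinate, and it is a
combination of `x` and `s` of norm at most `‖s‖`. -/
theorem IsScaled.step {ι : Type*} [Fintype ι] {u : OrthonormalBasis ι ℝ (Vec d)}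
    {lam p θ : ι → ℝ} {s x : Vec d} {h : ℝ} (hρ : 0 ≤ ρ) (hh : 0 ≤ h)
    (hB : (B : Vec d →ₗ[ℝ] Vec d).IsSymmetric) (hu : ∀ i, B (u i) = lam i • u i)
    (hs : cubicModelGrad ρ g B s = 0) (hpl : ∀ i, p i = lam i + ρ / 2 * ‖s‖)
    (hp0 : ∀ i, 0 ≤ p i) (hp : ∀ i, h * p i ≤ 1 / 2) (hR : h * (ρ * ‖s‖) ≤ 1)
    (H : IsScaled u p s x θ) :
    IsScaled u p s (x - h • cubicModelGrad ρ g B x)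
      (fun i => (1 + h * (ρ / 2 * (‖s‖ - ‖x‖)) - h * p i) * θ i + h * p i) := by
  set γ := ρ / 2 * (‖s‖ - ‖x‖) with hγ
  have hγ0 : 0 ≤ γ := mul_nonneg (by positivity) (sub_nonneg.2 H.norm_le)
  have hcoord : ∀ i, inner ℝ (u i) (x - h • cubicModelGrad ρ g B x)
      = ((1 + h * γ - h * p i) * θ i + h * p i) * inner ℝ (u i) s := by
    intro i
    have h1 : inner ℝ (u i) (cubicModelGrad ρ g B s) = 0 := by rw [hs, inner_zero_right]
    unfold cubicModelGrad at h1 ⊢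
    simp only [inner_add_right, inner_sub_right, real_inner_smul_right,
      inner_eigenbasis_apply hB hu, H.coord i] at h1 ⊢
    rw [hpl i, hγ]
    linear_combination (-h) * h1
  have hhγ : 0 ≤ h * γ := mul_nonneg hh hγ0
  have hhp : ∀ i, 0 ≤ h * p i := fun i => mul_nonneg hh (hp0 i)
  refine ⟨hcoord, fun i => ?_, fun i j hij => ?_, ?_⟩
  · have := H.nonneg i
    have : 0 ≤ (1 + h * γ - h * p i) * θ i := mul_nonneg (by linarith [hp i]) this
    linarith [hhp i]
  · have hj0 := H.nonneg j
    have hhj := hp j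
    by_cases hj : 1 ≤ θ j
    · refine (min_le_right _ _).trans ?_
      nlinarith [mul_nonneg (by linarith : 0 ≤ 1 - h * p j) (sub_nonneg.2 hj),
        mul_nonneg hhγ hj0]
    · have hij' := H.ordered i j hij
      have hi : θ i ≤ θ j := by
        rcases min_le_iff.1 hij' with h | h
        · exact h
        · exact absurd h hj
      refine (min_le_left _ _).trans ?_
      nlinarith [mul_nonneg (by linarith : 0 ≤ 1 + h * γ - h * p j) (sub_nonneg.2 hi),
        mul_nonneg (mul_nonneg hh (sub_nonneg.2 hij)) (by linarith : 0 ≤ 1 - θ i)]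
  · -- The threshold argument is applied to the products `h * p i`.
    have H' : IsScaled u (fun i => h * p i) s x θ ∨ h = 0 := by
      rcases hh.eq_or_lt with h0 | hpos
      · exact Or.inr h0.symm
      · exact Or.inl ⟨H.coord, H.nonneg, fun i j hij =>
          H.ordered i j (le_of_mul_le_mul_left hij hpos), H.norm_le⟩
    rcases H' with H' | rfl
    swap
    · simpa using H.norm_le
    obtain ⟨w, hw0, hw1, hw⟩ := H'.exists_threshold hhp hp (by norm_num)
    have hle : ‖x - h • cubicModelGrad ρ g B x‖ ^ 2
        ≤ ‖(1 + h * γ - w) • x + w • s‖ ^ 2 := by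
      rw [← u.sum_sq_inner_right, ← u.sum_sq_inner_right]
      refine Finset.sum_le_sum fun i _ => ?_
      rw [hcoord, inner_add_right, real_inner_smul_right, real_inner_smul_right, H.coord,
        ← mul_assoc (1 + h * γ - w), ← add_mul _ w, mul_pow, mul_pow]
      refine mul_le_mul_of_nonneg_right ?_ (sq_nonneg _)
      have h0 := H.nonneg i
      have h1 := hw i
      have h2 : 0 ≤ 2 * (1 + h * γ) * θ i - (h * p i + w) * (θ i - 1) := by
        nlinarith [mul_nonneg hhγ h0, hp i, hhp i,
          mul_nonneg (by linarith [hp i] : 0 ≤ 1 - (h * p i + w)) h0]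
      nlinarith [mul_nonneg h1 h2]
    have hle' := abs_le_of_sq_le_sq' hle (norm_nonneg _) |>.2
    refine hle'.trans ((norm_add_le _ _).trans ?_)
    rw [norm_smul, norm_smul, Real.norm_of_nonneg (by linarith), Real.norm_of_nonneg hw0]
    have h3 : h * (ρ * ‖x‖) ≤ 1 := le_trans (by gcongr; exact H.norm_le) hR
    have h4 : 0 ≤ (‖s‖ - ‖x‖) * (1 - w - h * (ρ * ‖x‖) / 2) :=
      mul_nonneg (sub_nonneg.2 H.norm_le) (by linarith)
    rw [hγ]
    nlinarith

/-- Gradient descent from `0` on the submodel never leaves the centered ball with its global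
minimizer on the boundary. -/
theorem norm_finalIterate_le {ℓ : ℝ} (hℓ : 0 < ℓ) (hρ : 0 ≤ ρ)
    (hB : (B : Vec d →ₗ[ℝ] Vec d).IsSymmetric) {s : Vec d}
    (hs : ∀ v, cubicModel ρ g B s ≤ cubicModel ρ g B v)
    (hBℓ : ‖B‖ ≤ 2 * ℓ) (hRℓ : ρ * ‖s‖ ≤ ℓ) (k : ℕ) :
    ‖finalIterate ℓ ρ g B k‖ ≤ ‖s‖ := by
  obtain ⟨u, lam, hu⟩ := exists_eigenbasis hB
  have hp0 : ∀ i, 0 ≤ lam i + ρ / 2 * ‖s‖ := fun i =>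
    eigenvalue_add_nonneg hρ hB hs (u.norm_eq_one i) (hu i)
  suffices h : ∃ θ, IsScaled u (fun i => lam i + ρ / 2 * ‖s‖) s (finalIterate ℓ ρ g B k) θ by
    obtain ⟨θ, hθ⟩ := h
    exact hθ.norm_le
  induction k with
  | zero =>
    refine ⟨fun _ => 0, ⟨fun i => ?_, fun i => le_rfl, fun i j _ => min_le_left _ _, ?_⟩⟩
    · simp [finalIterate]
    · simp [finalIterate]
  | succ k ih =>
    obtain ⟨θ, hθ⟩ := ih
    refine ⟨_, hθ.step hρ (by positivity) hB hu (cubicModelGrad_eq_zero hρ hB hs) (fun _ => rfl)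
      hp0 (fun i => ?_) ?_⟩
    · have := (le_abs_self _).trans ((abs_eigenvalue_le hu i).trans hBℓ)
      rw [one_div_mul_eq_div, div_le_iff₀ (by positivity)]
      nlinarith
    · rw [one_div_mul_eq_div, div_le_iff₀ (by positivity)]
      linarith

theorem cubicModel_gradient_step_le {ℓ R : ℝ} (hℓ : 0 < ℓ) (hρ : 0 ≤ ρ)
    (hB : (B : Vec d →ₗ[ℝ] Vec d).IsSymmetric)
    (hBℓ : ‖B‖ ≤ 2 * ℓ) (hRℓ : ρ * R ≤ ℓ) {x : Vec d} (hx : ‖x‖ ≤ R)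
    (hy : ‖x - (1 / (20 * ℓ)) • cubicModelGrad ρ g B x‖ ≤ R) :
    cubicModel ρ g B (x - (1 / (20 * ℓ)) • cubicModelGrad ρ g B x)
      ≤ cubicModel ρ g B x - 1 / (40 * ℓ) * ‖cubicModelGrad ρ g B x‖ ^ 2 := by
  set G := cubicModelGrad ρ g B x with hG
  rw [sub_eq_add_neg] at hy ⊢
  have h := cubicModel_add_le (g := g) hρ hB x (-((1 / (20 * ℓ)) • G))
  rw [← hG, inner_neg_left, real_inner_smul_left, real_inner_self_eq_norm_sq, norm_neg,
    norm_smul, Real.norm_of_nonneg (by positivity)] at h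
  refine h.trans ?_
  have h1 : (1 / 2 * ‖B‖ + ρ / 6 * ‖x + -((1 / (20 * ℓ)) • G)‖ + ρ / 3 * ‖x‖) ≤ 2 * ℓ := by
    have h2 : ρ / 6 * ‖x + -((1 / (20 * ℓ)) • G)‖ ≤ ρ / 6 * R := by gcongr
    have h3 : ρ / 3 * ‖x‖ ≤ ρ / 3 * R := by gcongr
    linarith
  have h2 := mul_le_mul_of_nonneg_right h1 (sq_nonneg (1 / (20 * ℓ) * ‖G‖))
  have h3 : 2 * ℓ * (1 / (20 * ℓ) * ‖G‖) ^ 2 = 1 / (200 * ℓ) * ‖G‖ ^ 2 := by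
    field_simp
    ring
  have h4 : 1 / (20 * ℓ) * ‖G‖ ^ 2 = 10 * (1 / (200 * ℓ) * ‖G‖ ^ 2) := by field_simp; ring
  have h5 : 1 / (40 * ℓ) * ‖G‖ ^ 2 = 5 * (1 / (200 * ℓ) * ‖G‖ ^ 2) := by field_simp; ring
  have h6 : 0 ≤ 1 / (200 * ℓ) * ‖G‖ ^ 2 := by positivity
  linarith

/-- If the cubic model has a global minimizer of norm at most `r / 2`, gradient descent finds a
point with small gradient after `O(ℓ² / (ρ r)²)` steps, without leaving the ball of radius
`r / 2`. -/
theorem exists_norm_cubicModelGrad_le {ℓ r : ℝ} (hℓ : 0 < ℓ) (hρ : 0 < ρ) (hr : 0 < r)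
    (hB : (B : Vec d →ₗ[ℝ] Vec d).IsSymmetric) (hBℓ : ‖B‖ ≤ ℓ + ρ * r / 1000) {s : Vec d}
    (hs : ∀ v, cubicModel ρ g B s ≤ cubicModel ρ g B v) (hsr : ‖s‖ ≤ r / 2) :
    ∃ k : ℕ, (k : ℝ) ≤ 40 * (ℓ ^ 2 / (ρ * r) ^ 2) ∧
      ‖cubicModelGrad ρ g B (finalIterate ℓ ρ g B k)‖ ≤ ρ * r ^ 2 / 2 ∧
      ∀ j ≤ k, ‖finalIterate ℓ ρ g B j‖ ≤ r / 2 := by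
  have hG := cubicModelGrad_eq_zero hρ.le hB hs
  have hρr : 0 < ρ * r := by positivity
  have hs0 := norm_nonneg s
  have hsr2 : ‖s‖ ^ 2 ≤ (r / 2) ^ 2 := by gcongr
  rcases le_or_gt (2 * ℓ) (ρ * r) with hcase | hcase
  · -- Here `g = -(B s + (ρ / 2) ‖s‖ s)` itself is already small.
    refine ⟨0, by simp only [Nat.cast_zero]; positivity, ?_, fun j hj => ?_⟩
    · have h1 : cubicModelGrad ρ g B (finalIterate ℓ ρ g B 0) = -(B s + (ρ / 2 * ‖s‖) • s) := by
        unfold cubicModelGrad at hG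
        simp only [cubicModelGrad, finalIterate, map_zero, smul_zero, add_zero]
        rw [eq_neg_iff_add_eq_zero, ← add_assoc]
        exact hG
      rw [h1, norm_neg]
      refine (norm_add_le _ _).trans ?_
      rw [norm_smul, Real.norm_of_nonneg (by positivity)]
      have h2 : ‖B s‖ ≤ (ρ * r / 2 + ρ * r / 1000) * (r / 2) :=
        (B.le_opNorm s).trans (by gcongr; linarith)
      have h3 : ρ / 2 * ‖s‖ * ‖s‖ ≤ ρ / 2 * (r / 2) * (r / 2) := by gcongr
      nlinarith
    · obtain rfl : j = 0 := by omega
      simp only [finalIterate, norm_zero]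
      positivity
  · have hBℓ2 : ‖B‖ ≤ 2 * ℓ := by linarith
    have hRℓ : ρ * ‖s‖ ≤ ℓ := by nlinarith
    have hnorm := norm_finalIterate_le hℓ hρ.le hB hs hBℓ2 hRℓ
    suffices h : ∃ k : ℕ, (k : ℝ) ≤ 40 * (ℓ ^ 2 / (ρ * r) ^ 2) ∧
        ‖cubicModelGrad ρ g B (finalIterate ℓ ρ g B k)‖ ≤ ρ * r ^ 2 / 2 by
      obtain ⟨k, h1, h2⟩ := h
      exact ⟨k, h1, h2, fun j _ => (hnorm j).trans hsr⟩
    by_contra! hcon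
    set N := ⌊40 * (ℓ ^ 2 / (ρ * r) ^ 2)⌋₊ with hN
    have hdesc : ∀ k ≤ N + 1, cubicModel ρ g B (finalIterate ℓ ρ g B k)
        ≤ -(k * ((ρ * r ^ 2) ^ 2 / (160 * ℓ))) := by
      intro k
      induction k with
      | zero => intro _; simp [cubicModel, finalIterate]
      | succ k ih =>
        intro hk
        have h1 := ih (by omega)
        have h2 := hcon k ((Nat.cast_le.2 (by omega : k ≤ N)).trans
          (Nat.floor_le (by positivity)))
        have h3 := cubicModel_gradient_step_le hℓ hρ.le hB hBℓ2 hRℓ (hnorm k) (hnorm (k + 1))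
        have h4 : 1 / (40 * ℓ) * (ρ * r ^ 2 / 2) ^ 2
            ≤ 1 / (40 * ℓ) * ‖cubicModelGrad ρ g B (finalIterate ℓ ρ g B k)‖ ^ 2 := by
          gcongr
        have h5 : 1 / (40 * ℓ) * (ρ * r ^ 2 / 2) ^ 2 = (ρ * r ^ 2) ^ 2 / (160 * ℓ) := by
          field_simp; norm_num
        change cubicModel ρ g B (finalIterate ℓ ρ g B k -
          (1 / (20 * ℓ)) • cubicModelGrad ρ g B (finalIterate ℓ ρ g B k)) ≤ _
        push_cast
        linarith
    have h1 := (hs _).trans (hdesc (N + 1) le_rfl)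
    have h2 : 40 * (ℓ ^ 2 / (ρ * r) ^ 2) < ((N + 1 : ℕ) : ℝ) := by
      push_cast
      exact Nat.lt_floor_add_one _
    have h3 : ℓ * r ^ 2 / 4 < ((N + 1 : ℕ) : ℝ) * ((ρ * r ^ 2) ^ 2 / (160 * ℓ)) := by
      calc ℓ * r ^ 2 / 4 = 40 * (ℓ ^ 2 / (ρ * r) ^ 2) * ((ρ * r ^ 2) ^ 2 / (160 * ℓ)) := by
            field_simp; norm_num
        _ < _ := by gcongr
    have h4 : -(ℓ * r ^ 2 / 4) ≤ cubicModel ρ g B s := by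
      rw [cubicModel_isMin_eq hρ.le hB hs]
      have h5 : inner ℝ s (B s) ≤ (ℓ + ρ * r / 1000) * ‖s‖ ^ 2 := by
        have h6 := real_inner_le_norm s (B s)
        have h7 := (B.le_opNorm s).trans (mul_le_mul_of_nonneg_right hBℓ hs0)
        nlinarith
      have h8 : (ℓ + ρ * r / 1000) * ‖s‖ ^ 2 ≤ (ℓ + 2 * ℓ / 1000) * ‖s‖ ^ 2 := by gcongr
      have h9 : ρ * ‖s‖ ^ 3 ≤ ℓ * ‖s‖ ^ 2 := by
        calc ρ * ‖s‖ ^ 3 = ρ * ‖s‖ * ‖s‖ ^ 2 := by ring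
          _ ≤ _ := by gcongr
      have h10 : ℓ * ‖s‖ ^ 2 ≤ ℓ * (r / 2) ^ 2 := by gcongr
      have h11 : 0 ≤ ℓ * ‖s‖ ^ 2 := by positivity
      linarith
    linarith

theorem finalSolver_spec {ℓ r ε : ℝ} (hℓ : 0 < ℓ) (hρ : 0 < ρ) (hr : 0 < r) (hε : ε = ρ * r ^ 2)
    (hB : (B : Vec d →ₗ[ℝ] Vec d).IsSymmetric) (hBℓ : ‖B‖ ≤ ℓ + ρ * r / 1000) {s : Vec d}
    (hs : ∀ v, cubicModel ρ g B s ≤ cubicModel ρ g B v) (hsr : ‖s‖ ≤ r / 2) :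
    ∃ (Δ : Vec d) (N : ℕ), finalSolver ℓ ρ ε g B = some (Δ, N) ∧ ‖Δ‖ ≤ r / 2 ∧
      ‖cubicModelGrad ρ g B Δ‖ ≤ ε / 2 ∧ (N : ℝ) ≤ 40 * (ℓ ^ 2 / (ρ * ε)) := by
  classical
  obtain ⟨k, hk1, hk2, hk3⟩ := exists_norm_cubicModelGrad_le hℓ hρ hr hB hBℓ hs hsr
  rw [← hε] at hk2
  have hex : ∃ k, ‖cubicModelGrad ρ g B (finalIterate ℓ ρ g B k)‖ ≤ ε / 2 := ⟨k, hk2⟩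
  have hle : Nat.find hex ≤ k := Nat.find_min' hex hk2
  refine ⟨_, _, dif_pos hex, hk3 _ ?_, ?_, ?_⟩
  · convert hle
  · convert Nat.find_spec hex
  · have hden : ρ * ε = (ρ * r) ^ 2 := by rw [hε]; ring
    rw [← hden] at hk1
    refine le_trans (Nat.cast_le.2 ?_) hk1
    convert hle

end GradientDescent

/-! ### Taylor expansion of the objective and analysis of one round -/

section Taylor

variable {d : ℕ} {F : Vec d → ℝ} {ℓ ρ : ℝ}

theorem fderiv_apply_eq_inner {F : Vec d → ℝ} {x : Vec d} (h : DifferentiableAt ℝ F x) (w : Vec d) :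
    fderiv ℝ F x w = inner ℝ (gradient F x) w := by
  rw [h.hasGradientAt.hasFDerivAt.fderiv, InnerProductSpace.toDual_apply_apply]

theorem IsSmooth.hasFDerivAt_gradient (hF : IsSmooth F ℓ ρ) (x : Vec d) :
    HasFDerivAt (gradient F) (hessian F x) x :=
  (hF.differentiable_gradient x).hasFDerivAt

theorem IsSmooth.continuous_gradient (hF : IsSmooth F ℓ ρ) : Continuous (gradient F) :=
  hF.differentiable_gradient.continuous

theorem IsSmooth.continuous_hessian (hF : IsSmooth F ℓ ρ) : Continuous (hessian F) :=
  (LipschitzWith.of_dist_le' fun x y => by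
    simpa only [dist_eq_norm] using hF.hessian_lipschitz x y).continuous

theorem IsSmooth.norm_hessian_le (hF : IsSmooth F ℓ ρ) (hℓ : 0 ≤ ℓ) (x : Vec d) :
    ‖hessian F x‖ ≤ ℓ := by
  have h : LipschitzWith ⟨ℓ, hℓ⟩ (gradient F) :=
    LipschitzWith.of_dist_le_mul fun x y => by
      simp only [dist_eq_norm]
      exact hF.gradient_lipschitz x y
  exact norm_fderiv_le_of_lipschitz ℝ h

theorem IsSmooth.norm_gradient_taylor_le (hF : IsSmooth F ℓ ρ) (x w : Vec d) :
    ‖gradient F (x + w) - gradient F x - hessian F x w‖ ≤ ρ / 2 * ‖w‖ ^ 2 := by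
  have hline : ∀ t : ℝ, HasDerivAt (fun t : ℝ => x + t • w) w t := fun t => by
    simpa using ((hasDerivAt_id t).smul_const w).const_add x
  have hd : ∀ t : ℝ, HasDerivAt
      (fun t : ℝ => gradient F (x + t • w) - gradient F x - t • hessian F x w)
      (hessian F (x + t • w) w - hessian F x w) t := fun t => by
    have h1 := (hF.hasFDerivAt_gradient (x + t • w)).comp_hasDerivAt t (hline t)
    have h2 := ((hasDerivAt_id t).smul_const (hessian F x w))
    simp only [one_smul] at h2
    exact (h1.sub_const _).sub h2
  have h := image_norm_le_of_norm_deriv_right_le_deriv_boundary (a := 0) (b := 1)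
    (B := fun t => ρ / 2 * ‖w‖ ^ 2 * t ^ 2) (B' := fun t => ρ / 2 * ‖w‖ ^ 2 * (2 * t))
    (fun t _ => (hd t).continuousAt.continuousWithinAt)
    (fun t _ => (hd t).hasDerivWithinAt) (by simp)
    (fun t => by simpa using (hasDerivAt_pow 2 t).const_mul (ρ / 2 * ‖w‖ ^ 2))
    (fun t ht => by
      rw [← sub_apply]
      have h1 := (hessian F (x + t • w) - hessian F x).le_opNorm w
      have h2 := hF.hessian_lipschitz (x + t • w) x
      rw [add_sub_cancel_left, norm_smul, Real.norm_of_nonneg ht.1] at h2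
      have h3 := mul_le_mul_of_nonneg_right h2 (norm_nonneg w)
      nlinarith) (Set.right_mem_Icc.2 zero_le_one)
  simpa using h

theorem IsSmooth.le_taylor (hF : IsSmooth F ℓ ρ) (x w : Vec d) :
    F (x + w) ≤ F x + inner ℝ w (gradient F x) + 1 / 2 * inner ℝ w (hessian F x w)
      + ρ / 6 * ‖w‖ ^ 3 := by
  have hline : ∀ t : ℝ, HasDerivAt (fun t : ℝ => x + t • w) w t := fun t => by
    simpa using ((hasDerivAt_id t).smul_const w).const_add x
  have hd : ∀ t : ℝ, HasDerivAt (fun t : ℝ => F (x + t • w) - F x - t * inner ℝ w (gradient F x)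
      - t ^ 2 * (1 / 2 * inner ℝ w (hessian F x w)))
      (inner ℝ w (gradient F (x + t • w) - gradient F x - hessian F x (t • w))) t := fun t => by
    have h1 := ((hF.differentiable (x + t • w)).hasFDerivAt).comp_hasDerivAt t (hline t)
    have h2 := (hasDerivAt_id t).mul_const (inner ℝ w (gradient F x))
    have h3 := (hasDerivAt_pow 2 t).mul_const (1 / 2 * inner ℝ w (hessian F x w))
    refine (((h1.sub_const (F x)).sub h2).sub h3).congr_deriv ?_
    rw [fderiv_apply_eq_inner (hF.differentiable _), inner_sub_right, inner_sub_right, map_smul,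
      real_inner_smul_right, real_inner_comm w]
    simp only [Nat.cast_ofNat, Nat.add_one_sub_one, pow_one]
    ring
  have h := image_norm_le_of_norm_deriv_right_le_deriv_boundary (a := 0) (b := 1)
    (B := fun t => ρ / 6 * ‖w‖ ^ 3 * t ^ 3) (B' := fun t => ρ / 6 * ‖w‖ ^ 3 * (3 * t ^ 2))
    (fun t _ => (hd t).continuousAt.continuousWithinAt)
    (fun t _ => (hd t).hasDerivWithinAt) (by simp)
    (fun t => by simpa using (hasDerivAt_pow 3 t).const_mul (ρ / 6 * ‖w‖ ^ 3))
    (fun t ht => by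
      have h1 := hF.norm_gradient_taylor_le x (t • w)
      rw [norm_smul, Real.norm_of_nonneg ht.1] at h1
      have h2 := norm_inner_le_norm (𝕜 := ℝ) w
        (gradient F (x + t • w) - gradient F x - hessian F x (t • w))
      have h3 := mul_le_mul_of_nonneg_left h1 (norm_nonneg w)
      nlinarith) (Set.right_mem_Icc.2 zero_le_one)
  have h' := (le_abs_self _).trans h
  simp only [one_smul, one_pow, one_mul, mul_one] at h'
  linarith

/-- The objective is bounded by the cubic model, up to the errors of `g` and `B`. -/
theorem IsSmooth.le_cubicModel (hF : IsSmooth F ℓ ρ) {x g : Vec d} {B : Vec d →L[ℝ] Vec d}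
    {e₁ e₂ : ℝ} (hg : ‖g - gradient F x‖ ≤ e₁) (hB : ‖B - hessian F x‖ ≤ e₂) (w : Vec d) :
    F (x + w) - F x ≤ cubicModel ρ g B w + e₁ * ‖w‖ + 1 / 2 * e₂ * ‖w‖ ^ 2 := by
  have h := hF.le_taylor x w
  have hn := norm_nonneg w
  have h1 : -(inner ℝ w (g - gradient F x)) ≤ e₁ * ‖w‖ := by
    have := (neg_le_abs _).trans (abs_real_inner_le_norm w (g - gradient F x))
    nlinarith
  have h2 : -(inner ℝ w ((B - hessian F x) w)) ≤ e₂ * ‖w‖ ^ 2 := by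
    have h3 := (neg_le_abs _).trans (abs_real_inner_le_norm w ((B - hessian F x) w))
    have h4 := ((B - hessian F x).le_opNorm w).trans (mul_le_mul_of_nonneg_right hB hn)
    nlinarith
  rw [inner_sub_right] at h1
  rw [sub_apply, inner_sub_right] at h2
  unfold cubicModel
  linarith

end Taylor

section Round

variable {d : ℕ} {F : Vec d → ℝ} {ℓ ρ r K κ c a : ℝ} {T : ℕ} {x g : Vec d}
  {B : Vec d →L[ℝ] Vec d} {P : OracleProc (Vec d)}

theorem sqrt_rho_mul_eps (hρ : 0 < ρ) (hr : 0 < r) : √(ρ * (ρ * r ^ 2)) = ρ * r := by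
  rw [show ρ * (ρ * r ^ 2) = (ρ * r) ^ 2 by ring, Real.sqrt_sq (by positivity)]

theorem sqrt_eps_div_rho (hρ : 0 < ρ) (hr : 0 < r) : √(ρ * r ^ 2 / ρ) = r := by
  rw [mul_div_cancel_left₀ _ hρ.ne', Real.sqrt_sq hr.le]

theorem sqrt_eps_cube_div_rho (hρ : 0 < ρ) (hr : 0 < r) :
    √((ρ * r ^ 2) ^ 3 / ρ) = ρ * r ^ 3 := by
  rw [show (ρ * r ^ 2) ^ 3 / ρ = (ρ * r ^ 3) ^ 2 by field_simp, Real.sqrt_sq (by positivity)]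

theorem ApproxMinimizer.model_le (hρ : 0 < ρ)
    (hB : (B : Vec d →ₗ[ℝ] Vec d).IsSymmetric) {s Δ : Vec d}
    (hs : ∀ v, cubicModel ρ g B s ≤ cubicModel ρ g B v)
    (h : cubicModel ρ g B Δ ≤ cubicModel ρ g B s + c / 12 * (ρ * ‖s‖ ^ 3)) :
    cubicModel ρ g B Δ ≤ -((1 - c) / 12 * (ρ * ‖s‖ ^ 3)) := by
  have := cubicModel_isMin_le hρ.le hB hs
  linarith

/-- If the claimed decrease of the submodel is large, the objective decreases. -/
theorem CallSucceeds.objective_decrease (hF : IsSmooth F ℓ ρ) (hρ : 0 < ρ) (hr : 0 < r)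
    (hκ : 0 < κ) (hκ' : κ ≤ 1 / 100) (hκK : κ < K) (hc' : c ≤ 1 / 30)
    (ha : 0 ≤ a) (haκ : a ≤ κ / 10) (hB : (B : Vec d →ₗ[ℝ] Vec d).IsSymmetric)
    (hgx : ‖g - gradient F x‖ ≤ a * (ρ * r ^ 2)) (hBx : ‖B - hessian F x‖ ≤ a * (ρ * r))
    (h : CallSucceeds F ρ (ρ * r ^ 2) K c T x g B P)
    (hdec : P.decrease B < -(κ * (ρ * r ^ 3))) :
    F (x + P.step B) ≤ F x - κ / 4 * (ρ * r ^ 3) := by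
  obtain ⟨-, hm, h⟩ := h
  have hr3 : 0 < ρ * r ^ 3 := by positivity
  rw [hm] at hdec
  set Δ := P.step B
  rcases h with h | ⟨s, hs, hΔ, hsm⟩
  · have h1 := (le_max_right _ _).trans h
    rw [sqrt_eps_cube_div_rho hρ hr] at h1
    nlinarith
  · rw [sqrt_eps_div_rho hρ hr] at hΔ hsm
    have hle := hF.le_cubicModel hgx hBx Δ
    have hΔ0 := norm_nonneg Δ
    have hcr : c * r ≤ 1 / 30 * r := by gcongr
    rcases lt_or_ge ‖s‖ (1 / 2 * r) with hlt | hge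
    · have h1 : ‖Δ‖ ≤ r := by linarith
      have h2 : a * (ρ * r ^ 2) * ‖Δ‖ ≤ a * (ρ * r ^ 2) * r := by gcongr
      have h3 : 1 / 2 * (a * (ρ * r)) * ‖Δ‖ ^ 2 ≤ 1 / 2 * (a * (ρ * r)) * r ^ 2 := by gcongr
      have h4 : a * (ρ * r ^ 3) ≤ κ / 10 * (ρ * r ^ 3) := by gcongr
      nlinarith
    · have h1 : ‖Δ‖ ≤ 2 * ‖s‖ := by linarith
      have h2 := ApproxMinimizer.model_le hρ hB hs (hsm hge)
      have hrs : r ≤ 2 * ‖s‖ := by linarith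
      have hs3 : r ^ 3 ≤ (2 * ‖s‖) ^ 3 := by gcongr
      have h3 : a * (ρ * r ^ 2) * ‖Δ‖ ≤ a * (ρ * (2 * ‖s‖) ^ 2) * (2 * ‖s‖) := by gcongr
      have h4 : 1 / 2 * (a * (ρ * r)) * ‖Δ‖ ^ 2
          ≤ 1 / 2 * (a * (ρ * (2 * ‖s‖))) * (2 * ‖s‖) ^ 2 := by gcongr
      have h5 : 0 ≤ ρ * ‖s‖ ^ 3 := by positivity
      have h6 : a * (ρ * ‖s‖ ^ 3) ≤ 1 / 1000 * (ρ * ‖s‖ ^ 3) := by gcongr; linarith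
      have h7 : c * (ρ * ‖s‖ ^ 3) ≤ 1 / 30 * (ρ * ‖s‖ ^ 3) := by gcongr
      have h8 : ρ * r ^ 3 ≤ 8 * (ρ * ‖s‖ ^ 3) := by nlinarith
      have h9 : κ * (ρ * r ^ 3) ≤ 1 / 100 * (ρ * r ^ 3) := by gcongr
      nlinarith

/-- If the claimed decrease of the submodel is small, its global minimizer is short. -/
theorem CallSucceeds.exists_short_minimizer (hρ : 0 < ρ) (hr : 0 < r)
    (hκ' : κ ≤ 1 / 100) (hκK : κ < K) (hc' : c ≤ 1 / 30)
    (hB : (B : Vec d →ₗ[ℝ] Vec d).IsSymmetric)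
    (h : CallSucceeds F ρ (ρ * r ^ 2) K c T x g B P)
    (hdec : -(κ * (ρ * r ^ 3)) ≤ P.decrease B) :
    ∃ s, ‖s‖ ≤ r / 2 ∧ ∀ v, cubicModel ρ g B s ≤ cubicModel ρ g B v := by
  obtain ⟨-, hm, h⟩ := h
  have hr3 : 0 < ρ * r ^ 3 := by positivity
  rw [hm] at hdec
  set Δ := P.step B
  rcases h with h | ⟨s, hs, -, hsm⟩
  · have h1 := (le_max_left _ _).trans h
    rw [sqrt_eps_cube_div_rho hρ hr] at h1
    nlinarith
  · rw [sqrt_eps_div_rho hρ hr] at hsm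
    refine ⟨s, ?_, hs⟩
    by_contra! hlt
    have h2 := ApproxMinimizer.model_le hρ hB hs (hsm (by linarith))
    have h3 : r ^ 3 ≤ (2 * ‖s‖) ^ 3 := by gcongr; linarith
    have h8 : ρ * r ^ 3 ≤ 8 * (ρ * ‖s‖ ^ 3) := by nlinarith
    have h7 : c * (ρ * ‖s‖ ^ 3) ≤ 1 / 30 * (ρ * ‖s‖ ^ 3) := by gcongr
    have h9 : κ * (ρ * r ^ 3) ≤ 1 / 100 * (ρ * r ^ 3) := by gcongr
    nlinarith

/-- A nearly stationary point of the submodel in the ball of radius `r / 2` leads to a second-order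
stationary point when the global minimizer of the submodel is short. -/
theorem isSecondOrderStationary_of_short (hF : IsSmooth F ℓ ρ) (hρ : 0 < ρ) (hr : 0 < r)
    (ha : a ≤ 1 / 1000) (hB : (B : Vec d →ₗ[ℝ] Vec d).IsSymmetric)
    (hgx : ‖g - gradient F x‖ ≤ a * (ρ * r ^ 2)) (hBx : ‖B - hessian F x‖ ≤ a * (ρ * r))
    {s Δ : Vec d} (hs : ∀ v, cubicModel ρ g B s ≤ cubicModel ρ g B v) (hsr : ‖s‖ ≤ r / 2)
    (hΔ : ‖Δ‖ ≤ r / 2) (hgrad : ‖cubicModelGrad ρ g B Δ‖ ≤ ρ * r ^ 2 / 2) :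
    IsSecondOrderStationary F ρ (ρ * r ^ 2) (x + Δ) := by
  have hρr : 0 < ρ * r := by positivity
  have hρr2 : 0 < ρ * r ^ 2 := by positivity
  have hBx' : ‖B - hessian F x‖ ≤ 1 / 1000 * (ρ * r) := hBx.trans (by gcongr)
  have hgx' : ‖g - gradient F x‖ ≤ 1 / 1000 * (ρ * r ^ 2) := hgx.trans (by gcongr)
  constructor
  · have h1 := hF.norm_gradient_taylor_le x Δ
    have h2 : gradient F (x + Δ) = (gradient F (x + Δ) - gradient F x - hessian F x Δ)
        + (cubicModelGrad ρ g B Δ - (ρ / 2 * ‖Δ‖) • Δ - (g - gradient F x)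
          - (B - hessian F x) Δ) := by
      unfold cubicModelGrad
      rw [sub_apply]
      abel
    rw [h2]
    refine (norm_add_le _ _).trans ?_
    have h3 : ‖cubicModelGrad ρ g B Δ - (ρ / 2 * ‖Δ‖) • Δ - (g - gradient F x)
          - (B - hessian F x) Δ‖ ≤ ‖cubicModelGrad ρ g B Δ‖ + ‖(ρ / 2 * ‖Δ‖) • Δ‖
          + ‖g - gradient F x‖ + ‖(B - hessian F x) Δ‖ :=
      (norm_sub_le _ _).trans (add_le_add_left ((norm_sub_le _ _).trans
        (add_le_add_left (norm_sub_le _ _) _)) _)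
    have h4 : ‖(ρ / 2 * ‖Δ‖) • Δ‖ = ρ / 2 * ‖Δ‖ ^ 2 := by
      rw [norm_smul, Real.norm_of_nonneg (by positivity)]
      ring
    have h5 : ρ / 2 * ‖Δ‖ ^ 2 ≤ ρ / 2 * (r / 2) ^ 2 := by gcongr
    have h6 : ‖(B - hessian F x) Δ‖ ≤ 1 / 1000 * (ρ * r) * (r / 2) :=
      ((B - hessian F x).le_opNorm Δ).trans (by gcongr)
    nlinarith
  · intro μ hμ
    obtain ⟨v, hv⟩ := hμ.exists_hasEigenvector
    have hv0 : 0 < ‖v‖ ^ 2 := by have := norm_pos_iff.2 hv.2; positivity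
    have hev : hessian F (x + Δ) v = μ • v := hv.apply_eq_smul
    rw [sqrt_rho_mul_eps hρ hr]
    have h1 := neg_norm_le_inner_of_isMin hρ.le hB hs v
    have h2 : ‖B - hessian F (x + Δ)‖ ≤ 1 / 1000 * (ρ * r) + ρ * (r / 2) := by
      have h3 := hF.hessian_lipschitz x (x + Δ)
      rw [sub_add_cancel_left, norm_neg] at h3
      have h4 : ρ * ‖Δ‖ ≤ ρ * (r / 2) := by gcongr
      have h5 : B - hessian F (x + Δ) = (B - hessian F x) + (hessian F x - hessian F (x + Δ)) := by
        abel
      rw [h5]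
      refine (norm_add_le _ _).trans ?_
      linarith
    have h6 : inner ℝ v ((B - hessian F (x + Δ)) v)
        ≤ (1 / 1000 * (ρ * r) + ρ * (r / 2)) * ‖v‖ ^ 2 := by
      have h7 := real_inner_le_norm v ((B - hessian F (x + Δ)) v)
      have h8 := ((B - hessian F (x + Δ)).le_opNorm v).trans
        (mul_le_mul_of_nonneg_right h2 (norm_nonneg v))
      have := norm_nonneg v
      nlinarith
    rw [sub_apply, inner_sub_right, hev, real_inner_smul_right, real_inner_self_eq_norm_sq] at h6
    have h9 : ρ / 2 * ‖s‖ * ‖v‖ ^ 2 ≤ ρ / 2 * (r / 2) * ‖v‖ ^ 2 := by gcongr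
    have h10 : -(ρ * r) * ‖v‖ ^ 2 ≤ μ * ‖v‖ ^ 2 := by nlinarith
    exact le_of_mul_le_mul_right h10 hv0

end Round

/-! ### Stochastic derivatives: measurability and unbiasedness -/

section Derivatives

variable {d : ℕ}

theorem gradient_eq_sum (h : Vec d → ℝ) (x : Vec d) :
    gradient h x = ∑ i, fderiv ℝ h x (EuclideanSpace.basisFun (Fin d) ℝ i) •
      EuclideanSpace.basisFun (Fin d) ℝ i := by
  rw [← (EuclideanSpace.basisFun (Fin d) ℝ).sum_repr' (gradient h x)]
  refine Finset.sum_congr rfl fun i _ => ?_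
  rw [gradient, real_inner_comm, ← InnerProductSpace.toDual_apply_apply (𝕜 := ℝ),
    LinearIsometryEquiv.apply_symm_apply]

theorem contDiff_gradient {h : Vec d → ℝ} (hh : ContDiff ℝ 2 h) : ContDiff ℝ 1 (gradient h) := by
  have h1 : gradient h = fun x => ∑ i, fderiv ℝ h x (EuclideanSpace.basisFun (Fin d) ℝ i) •
      EuclideanSpace.basisFun (Fin d) ℝ i := funext (gradient_eq_sum h)
  rw [h1]
  refine ContDiff.sum fun i _ => ContDiff.fun_smul ?_ contDiff_const
  exact (hh.fderiv_right (m := 1) (by norm_num)).clm_apply contDiff_const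

theorem continuous_hessian {h : Vec d → ℝ} (hh : ContDiff ℝ 2 h) : Continuous (hessian h) :=
  (contDiff_gradient hh).continuous_fderiv one_ne_zero

theorem isSymmetric_hessian {h : Vec d → ℝ} (hh : ContDiff ℝ 2 h) (x : Vec d) :
    (hessian h x : Vec d →ₗ[ℝ] Vec d).IsSymmetric := by
  have key : ∀ v w, inner ℝ (hessian h x v) w = fderiv ℝ (fderiv ℝ h) x v w := by
    intro v w
    have h1 : HasFDerivAt (gradient h) (hessian h x) x :=
      ((contDiff_gradient hh).differentiable one_ne_zero x).hasFDerivAt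
    have h2 : HasFDerivAt (fderiv ℝ h) (fderiv ℝ (fderiv ℝ h) x) x :=
      (((hh.fderiv_right (m := 1) (by norm_num)).differentiable one_ne_zero) x).hasFDerivAt
    have h3 := h2.clm_apply (hasFDerivAt_const w x)
    have h4 := h1.inner ℝ (hasFDerivAt_const w x)
    have h5 : (fun y => inner ℝ (gradient h y) w) = fun y => fderiv ℝ h y w := by
      funext y
      rw [fderiv_apply_eq_inner (hh.differentiable two_ne_zero y)]
    rw [h5] at h4
    have h6 := congrArg (fun L => L v) (h4.unique h3)
    simpa using h6
  intro v w
  simp only [ContinuousLinearMap.coe_coe]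
  rw [key, real_inner_comm, key]
  exact (hh.contDiffAt.isSymmSndFDerivAt (by simp)) v w

end Derivatives

section Measurability

variable {d : ℕ} {Ξ : Type*} [MeasurableSpace Ξ]

/-- The derivative of a parametrized function depends measurably on the parameter: it is built
from limits of difference quotients in the coordinate directions. -/
theorem measurable_fderiv_param {F : Type*} [NormedAddCommGroup F] [NormedSpace ℝ F]
    [SecondCountableTopology F] [MeasurableSpace F] [BorelSpace F] {G : Vec d → Ξ → F}
    (hG : ∀ ξ, Differentiable ℝ fun x => G x ξ) (hm : ∀ x, Measurable (G x)) (x : Vec d) :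
    Measurable fun ξ => fderiv ℝ (fun x => G x ξ) x := by
  have h1 : ∀ v : Vec d, Measurable fun ξ => fderiv ℝ (fun x => G x ξ) x v := by
    intro v
    refine measurable_of_tendsto_metrizable (f := fun (n : ℕ) ξ =>
      (n : ℝ) • (G (x + (n : ℝ)⁻¹ • v) ξ - G x ξ)) (fun n => ?_) ?_
    · exact ((hm _).sub (hm _)).const_smul _
    · rw [tendsto_pi_nhds]
      intro ξ
      refine (hG ξ x).hasFDerivAt.lim v ?_
      simpa using tendsto_natCast_atTop_atTop (R := ℝ)
  have h2 : ∀ ξ, fderiv ℝ (fun x => G x ξ) x = ∑ i : Fin d,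
      ContinuousLinearMap.smulRightL ℝ (Vec d) F (EuclideanSpace.proj i)
        (fderiv ℝ (fun x => G x ξ) x (EuclideanSpace.basisFun (Fin d) ℝ i)) := by
    intro ξ
    ext1 v
    rw [sum_apply]
    conv_lhs => rw [← (EuclideanSpace.basisFun (Fin d) ℝ).sum_repr v, map_sum]
    refine Finset.sum_congr rfl fun i _ => ?_
    rw [map_smul]
    simp
  rw [funext h2]
  refine Finset.measurable_fun_sum _ fun i _ => ?_
  exact (ContinuousLinearMap.continuous _).measurable.comp (h1 _)

variable {D : Measure Ξ} {f : Vec d → Ξ → ℝ}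

theorem IsStochasticFunction.measurable_gradient (hf : IsStochasticFunction D f) (x : Vec d) :
    Measurable fun ξ => gradient (fun y => f y ξ) x := by
  simp_rw [gradient_eq_sum]
  refine Finset.measurable_fun_sum _ fun i _ => Measurable.smul_const ?_ _
  exact (ContinuousLinearMap.apply ℝ ℝ _).continuous.measurable.comp
    (measurable_fderiv_param (fun ξ => (hf.contDiff ξ).differentiable two_ne_zero) hf.measurable x)

theorem IsStochasticFunction.measurable_hessian (hf : IsStochasticFunction D f) (x : Vec d) :
    Measurable fun ξ => hessian (fun y => f y ξ) x :=
  measurable_fderiv_param (G := fun x ξ => gradient (fun y => f y ξ) x)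
    (fun ξ => (contDiff_gradient (hf.contDiff ξ)).differentiable one_ne_zero)
    hf.measurable_gradient x

theorem IsStochasticFunction.measurable_uncurry_gradient (hf : IsStochasticFunction D f) :
    Measurable fun p : Vec d × Ξ => gradient (fun y => f y p.2) p.1 :=
  measurable_uncurry_of_continuous_of_measurable
    (u := fun x ξ => gradient (fun y => f y ξ) x)
    (fun ξ => (contDiff_gradient (hf.contDiff ξ)).continuous) hf.measurable_gradient

theorem IsStochasticFunction.measurable_uncurry_hessian (hf : IsStochasticFunction D f) :
    Measurable fun p : Vec d × Ξ => hessian (fun y => f y p.2) p.1 :=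
  measurable_uncurry_of_continuous_of_measurable
    (u := fun x ξ => hessian (fun y => f y ξ) x)
    (fun ξ => continuous_hessian (hf.contDiff ξ)) hf.measurable_hessian

theorem IsStochasticFunction.measurable_avgGradient (hf : IsStochasticFunction D f) (n : ℕ) :
    Measurable fun p : Vec d × (Fin n → Ξ) => avgGradient f p.2 p.1 := by
  unfold avgGradient
  refine Measurable.const_smul (c := 1 / (n : ℝ)) (Finset.measurable_fun_sum _ fun i _ => ?_)
  exact hf.measurable_uncurry_gradient.comp
    (measurable_fst.prodMk ((measurable_pi_apply i).comp measurable_snd))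

theorem IsStochasticFunction.measurable_avgHessian (hf : IsStochasticFunction D f) (n : ℕ) :
    Measurable fun p : Vec d × (Fin n → Ξ) => avgHessian f p.2 p.1 := by
  unfold avgHessian
  refine Measurable.const_smul (c := 1 / (n : ℝ)) (Finset.measurable_fun_sum _ fun i _ => ?_)
  exact hf.measurable_uncurry_hessian.comp
    (measurable_fst.prodMk ((measurable_pi_apply i).comp measurable_snd))

theorem IsStochasticFunction.isSymmetric_avgHessian (hf : IsStochasticFunction D f) {n : ℕ}
    (s : Fin n → Ξ) (x : Vec d) :
    (avgHessian f s x : Vec d →ₗ[ℝ] Vec d).IsSymmetric := by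
  intro v w
  have h' := fun i => isSymmetric_hessian (hf.contDiff (s i)) x v w
  simp only [ContinuousLinearMap.coe_coe] at h'
  simp [avgHessian, sum_inner, inner_sum, inner_smul_left, inner_smul_right, h']

end Measurability

section Unbiased

variable {d : ℕ} {Ξ : Type*} [MeasurableSpace Ξ] {D : Measure Ξ} [IsProbabilityMeasure D]

/-- Differentiation under the integral when, at each point, the derivative is almost surely within
`M` of a continuous function. By continuity the exceptional null sets can be chosen independent of
the point, which gives a locally uniform bound. -/
theorem hasFDerivAt_integral_of_close {F : Type*} [NormedAddCommGroup F] [NormedSpace ℝ F]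
    [SecondCountableTopology F] [MeasurableSpace F] [BorelSpace F]
    {G : Vec d → Ξ → F} {Φ : Vec d → Vec d →L[ℝ] F} {M : ℝ}
    (hG : ∀ ξ, ContDiff ℝ 1 fun x => G x ξ) (hm : ∀ x, Measurable (G x))
    (hi : ∀ x, Integrable (G x) D) (hΦ : Continuous Φ)
    (hb : ∀ x, ∀ᵐ ξ ∂D, ‖fderiv ℝ (fun y => G y ξ) x - Φ x‖ ≤ M) (x : Vec d) :
    HasFDerivAt (fun x => ∫ ξ, G x ξ ∂D) (∫ ξ, fderiv ℝ (fun y => G y ξ) x ∂D) x := by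
  have hm' := measurable_fderiv_param (fun ξ => (hG ξ).differentiable one_ne_zero) hm
  have hall : ∀ᵐ ξ ∂D, ∀ y, ‖fderiv ℝ (fun y => G y ξ) y - Φ y‖ ≤ M := by
    have h1 : ∀ᵐ ξ ∂D, ∀ n, ‖fderiv ℝ (fun y => G y ξ) (TopologicalSpace.denseSeq (Vec d) n)
        - Φ (TopologicalSpace.denseSeq (Vec d) n)‖ ≤ M := ae_all_iff.2 fun n => hb _
    filter_upwards [h1] with ξ hξ y
    have hcl : IsClosed {y | ‖fderiv ℝ (fun y => G y ξ) y - Φ y‖ ≤ M} :=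
      isClosed_le (((hG ξ).continuous_fderiv one_ne_zero).sub hΦ).norm continuous_const
    have := hcl.closure_subset_iff.2 (Set.range_subset_iff.2 hξ)
    exact this ((TopologicalSpace.denseRange_denseSeq (Vec d)) y)
  obtain ⟨C, hC⟩ := (isCompact_closedBall x 1).exists_bound_of_continuousOn hΦ.continuousOn
  refine hasFDerivAt_integral_of_dominated_of_fderiv_le (F := G)
    (F' := fun x ξ => fderiv ℝ (fun y => G y ξ) x) (bound := fun _ => M + C)
    (Metric.closedBall_mem_nhds x one_pos)
    (Filter.Eventually.of_forall fun y => (hm y).aestronglyMeasurable) (hi x)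
    (hm' x).aestronglyMeasurable ?_ (integrable_const _)
    (ae_of_all _ fun ξ y _ => ((hG ξ).differentiable one_ne_zero y).hasFDerivAt)
  filter_upwards [hall] with ξ hξ y hy
  calc ‖fderiv ℝ (fun y => G y ξ) y‖
      = ‖(fderiv ℝ (fun y => G y ξ) y - Φ y) + Φ y‖ := by rw [sub_add_cancel]
    _ ≤ M + C := (norm_add_le _ _).trans (add_le_add (hξ y) (hC y hy))

variable {f : Vec d → Ξ → ℝ} {ℓ ρ σ₁ M₁ σ₂ M₂ : ℝ}

theorem integrable_of_close {F : Type*} [NormedAddCommGroup F] [MeasurableSpace F] [BorelSpace F]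
    [SecondCountableTopology F] {Y : Ξ → F} {m : F} {M : ℝ} (hY : Measurable Y)
    (hb : ∀ᵐ ξ ∂D, ‖Y ξ - m‖ ≤ M) : Integrable Y D := by
  have h : Integrable (fun ξ => Y ξ - m) D :=
    Integrable.of_bound (hY.sub_const m).aestronglyMeasurable M hb
  exact (h.add (integrable_const m)).congr (ae_of_all _ fun ξ => sub_add_cancel _ _)

theorem integral_gradient (hf : IsStochasticFunction D f) (hF : IsSmooth (objective D f) ℓ ρ)
    (hN : HasBoundedNoise D f σ₁ M₁ σ₂ M₂) (x : Vec d) :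
    ∫ ξ, gradient (fun y => f y ξ) x ∂D = gradient (objective D f) x := by
  have hgi : Integrable (fun ξ => gradient (fun y => f y ξ) x) D :=
    integrable_of_close (hf.measurable_gradient x) (hN.gradient_bounded x)
  have hdual : ∀ h : Vec d → ℝ, ∀ y, fderiv ℝ h y = InnerProductSpace.toDual ℝ _ (gradient h y) :=
    fun h y => by rw [gradient, LinearIsometryEquiv.apply_symm_apply]
  have hb : ∀ y, ∀ᵐ ξ ∂D, ‖fderiv ℝ (fun y => f y ξ) y - fderiv ℝ (objective D f) y‖ ≤ M₁ := by
    intro y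
    filter_upwards [hN.gradient_bounded y] with ξ hξ
    rwa [hdual, hdual, ← map_sub, LinearIsometryEquiv.norm_map]
  have hcont : Continuous fun y => fderiv ℝ (objective D f) y := by
    rw [funext (hdual (objective D f))]
    exact (LinearIsometryEquiv.continuous _).comp hF.continuous_gradient
  have hd := hasFDerivAt_integral_of_close (G := f)
    (fun ξ => (hf.contDiff ξ).of_le (by norm_num)) hf.measurable hf.integrable hcont hb x
  have hfi : Integrable (fun ξ => fderiv ℝ (fun y => f y ξ) x) D :=
    integrable_of_close (measurable_fderiv_param
      (fun ξ => (hf.contDiff ξ).differentiable two_ne_zero) hf.measurable x) (hb x)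
  refine ext_inner_right ℝ fun v => ?_
  rw [← fderiv_apply_eq_inner (hF.differentiable x)]
  have h1 : fderiv ℝ (objective D f) x = ∫ ξ, fderiv ℝ (fun y => f y ξ) x ∂D := hd.fderiv
  rw [h1, ContinuousLinearMap.integral_apply hfi, real_inner_comm, ← integral_inner hgi]
  refine integral_congr_ae (ae_of_all _ fun ξ => ?_)
  simp only
  rw [fderiv_apply_eq_inner ((hf.contDiff ξ).differentiable two_ne_zero x), real_inner_comm]

theorem integral_hessian (hf : IsStochasticFunction D f) (hF : IsSmooth (objective D f) ℓ ρ)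
    (hN : HasBoundedNoise D f σ₁ M₁ σ₂ M₂) (x : Vec d) :
    ∫ ξ, hessian (fun y => f y ξ) x ∂D = hessian (objective D f) x := by
  have hd := hasFDerivAt_integral_of_close (D := D)
    (G := fun x ξ => gradient (fun y => f y ξ) x) (Φ := hessian (objective D f)) (M := M₂)
    (fun ξ => contDiff_gradient (hf.contDiff ξ)) hf.measurable_gradient
    (fun y => integrable_of_close (hf.measurable_gradient y) (hN.gradient_bounded y))
    hF.continuous_hessian hN.hessian_bounded x
  simp_rw [integral_gradient hf hF hN] at hd
  exact hd.fderiv.symm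

theorem isSymmetric_hessian_objective (hf : IsStochasticFunction D f)
    (hF : IsSmooth (objective D f) ℓ ρ) (hN : HasBoundedNoise D f σ₁ M₁ σ₂ M₂) (x : Vec d) :
    (hessian (objective D f) x : Vec d →ₗ[ℝ] Vec d).IsSymmetric := by
  have hi : Integrable (fun ξ => hessian (fun y => f y ξ) x) D :=
    integrable_of_close (hf.measurable_hessian x) (hN.hessian_bounded x)
  have hv : ∀ v, Integrable (fun ξ => hessian (fun y => f y ξ) x v) D := fun v =>
    (ContinuousLinearMap.apply ℝ (Vec d) v).integrable_comp hi
  intro v w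
  simp only [ContinuousLinearMap.coe_coe]
  rw [← integral_hessian hf hF hN, ContinuousLinearMap.integral_apply hi,
    ContinuousLinearMap.integral_apply hi, real_inner_comm, ← integral_inner (hv v),
    ← integral_inner (hv w)]
  refine integral_congr_ae (ae_of_all _ fun ξ => ?_)
  simp only
  rw [real_inner_comm]
  exact isSymmetric_hessian (hf.contDiff ξ) x v w

theorem average_sub {V : Type*} [AddCommGroup V] [Module ℝ V] {n : ℕ} (hn : 0 < n)
    (y : Fin n → V) (m : V) :
    (1 / (n : ℝ)) • ∑ i, (y i - m) = (1 / (n : ℝ)) • ∑ i, y i - m := by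
  have hn' : (n : ℝ) ≠ 0 := by positivity
  rw [Finset.sum_sub_distrib, smul_sub, Finset.sum_const, Finset.card_univ, Fintype.card_fin,
    ← Nat.cast_smul_eq_nsmul ℝ, smul_smul, one_div_mul_cancel hn', one_smul]

theorem measure_avgGradient_gt_le (hd : 0 < d) (hf : IsStochasticFunction D f)
    (hF : IsSmooth (objective D f) ℓ ρ) (hN : HasBoundedNoise D f σ₁ M₁ σ₂ M₂) {t Λ : ℝ} {n : ℕ}
    (hn : 0 < n) (ht : 0 < t) (hΛ : 0 < Λ) (hM : 8 * Λ * M₁ ≤ n * t)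
    (hσ : 64 * Λ * σ₁ ^ 2 ≤ n * t ^ 2) (x : Vec d) :
    (Measure.pi fun _ : Fin n => D) {s | t < ‖avgGradient f s x - gradient (objective D f) x‖}
      ≤ ENNReal.ofReal (2 * d * Real.exp (-Λ)) := by
  have h := measure_norm_average_vec_gt_le (D := D) hd
    (Y := fun ξ => gradient (fun y => f y ξ) x - gradient (objective D f) x)
    ((hf.measurable_gradient x).sub_const _)
    (by
      rw [integral_sub (integrable_of_close (hf.measurable_gradient x) (hN.gradient_bounded x))
        (integrable_const _), integral_gradient hf hF hN]
      simp)
    (hN.gradient_bounded x) (hN.gradient_variance x) hn ht hΛ hM hσ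
  simp_rw [average_sub hn] at h
  exact h

theorem measure_avgHessian_gt_le (hf : IsStochasticFunction D f)
    (hF : IsSmooth (objective D f) ℓ ρ) (hN : HasBoundedNoise D f σ₁ M₁ σ₂ M₂) {t Λ : ℝ} {n : ℕ}
    (hn : 0 < n) (ht : 0 < t) (hΛ : 0 < Λ) (hM : 4 * Λ * M₂ ≤ n * t)
    (hσ : 16 * Λ * σ₂ ^ 2 ≤ n * t ^ 2) (x : Vec d) :
    (Measure.pi fun _ : Fin n => D) {s | t < ‖avgHessian f s x - hessian (objective D f) x‖}
      ≤ ENNReal.ofReal (2 * d * Real.exp (-Λ)) := by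
  have h := measure_norm_average_gt_le (D := D)
    (Y := fun ξ => hessian (fun y => f y ξ) x - hessian (objective D f) x)
    ((hf.measurable_hessian x).sub_const _)
    (fun ξ => by
      rw [ContinuousLinearMap.toLinearMap_sub]
      exact (isSymmetric_hessian (hf.contDiff ξ) x).sub (isSymmetric_hessian_objective hf hF hN x))
    (by
      rw [integral_sub (integrable_of_close (hf.measurable_hessian x) (hN.hessian_bounded x))
        (integrable_const _), integral_hessian hf hF hN]
      simp)
    (hN.hessian_bounded x) (hN.hessian_variance x) hn ht hΛ hM hσ
  simp_rw [average_sub hn] at h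
  exact h

end Unbiased

/-! ### The run of the algorithm -/

section Rounds

variable {d : ℕ} {Ξ S : Type*} {n₁ n₂ : ℕ}

/-- The next iterate after a round that does not call the final solver. -/
def nextPoint (f : Vec d → Ξ → ℝ) (A : Subsolver S d) (x : Vec d) (w : Round Ξ S n₁ n₂) : Vec d :=
  x + (A w.2.2 (avgGradient f w.1 x)).step (avgHessian f w.2.1 x)

/-- The claimed change of the submodel in a round. -/
def roundDecrease (f : Vec d → Ξ → ℝ) (A : Subsolver S d) (x : Vec d) (w : Round Ξ S n₁ n₂) : ℝ :=
  (A w.2.2 (avgGradient f w.1 x)).decrease (avgHessian f w.2.1 x)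

/-- The submodel with data `g, B` has a global minimizer in the ball of radius `R`. -/
def HasShortMinimizer (ρ R : ℝ) (g : Vec d) (B : Vec d →L[ℝ] Vec d) : Prop :=
  ∃ s, ‖s‖ ≤ R ∧ ∀ v, cubicModel ρ g B s ≤ cubicModel ρ g B v

/-- A successful round at the iterate `x`, with threshold `η` for the claimed decrease: the
averages are accurate, few products are used, a small claimed decrease certifies a short minimizer
of the submodel and a large one a decrease of the objective. This consequence of `CallSucceeds` is
stated without the minimizer selected there, which makes its measurability easy to see. -/
structure RoundGood (F : Vec d → ℝ) (f : Vec d → Ξ → ℝ) (A : Subsolver S d) (ρ R η e₁ e₂ : ℝ)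
    (T : ℕ) (x : Vec d) (w : Round Ξ S n₁ n₂) : Prop where
  gradient_le : ‖avgGradient f w.1 x - gradient F x‖ ≤ e₁
  hessian_le : ‖avgHessian f w.2.1 x - hessian F x‖ ≤ e₂
  queries_le : (A w.2.2 (avgGradient f w.1 x)).queries (avgHessian f w.2.1 x) ≤ T
  short : -η ≤ roundDecrease f A x w →
    HasShortMinimizer ρ R (avgGradient f w.1 x) (avgHessian f w.2.1 x)
  decrease : roundDecrease f A x w < -η → F (nextPoint f A x w) ≤ F x - η / 4

/-- The first `k` of the given rounds, started at `x`, are successful up to and including the one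
that calls the final solver. -/
def AllGood (F : Vec d → ℝ) (f : Vec d → Ξ → ℝ) (A : Subsolver S d) (ρ R η e₁ e₂ : ℝ) (T : ℕ) :
    ℕ → List (Round Ξ S n₁ n₂) → Vec d → Prop
  | 0, _, _ => True
  | _ + 1, [], _ => True
  | k + 1, w :: ws, x => RoundGood F f A ρ R η e₁ e₂ T x w ∧
      (roundDecrease f A x w < -η → AllGood F f A ρ R η e₁ e₂ T k ws (nextPoint f A x w))

end Rounds

section RoundsMeasurable

variable {d : ℕ} {Ξ S : Type*} [MeasurableSpace Ξ] [MeasurableSpace S] {D : Measure Ξ}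
  {n₁ n₂ : ℕ} {f : Vec d → Ξ → ℝ} {A : Subsolver S d} {F : Vec d → ℝ} {ρ R η e₁ e₂ ℓ : ℝ} {T : ℕ}

theorem continuous_cubicModel : Continuous fun p : Vec d × Vec d × (Vec d →L[ℝ] Vec d) =>
    cubicModel ρ p.2.1 p.2.2 p.1 := by
  unfold cubicModel
  fun_prop

/-- Having a short minimizer is a closed condition, by compactness of the ball. -/
theorem isClosed_hasShortMinimizer :
    IsClosed {p : Vec d × (Vec d →L[ℝ] Vec d) | HasShortMinimizer ρ R p.1 p.2} := by
  have : CompactSpace (Metric.closedBall (0 : Vec d) R) :=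
    isCompact_iff_compactSpace.1 (isCompact_closedBall _ _)
  have hcl : IsClosed {q : Metric.closedBall (0 : Vec d) R × (Vec d × (Vec d →L[ℝ] Vec d)) |
      ∀ v, cubicModel ρ q.2.1 q.2.2 q.1 ≤ cubicModel ρ q.2.1 q.2.2 v} := by
    simp only [Set.ofPred_forall]
    refine isClosed_iInter fun v => isClosed_le ?_ ?_
    · exact continuous_cubicModel.comp
        ((continuous_subtype_val.comp continuous_fst).prodMk continuous_snd)
    · exact continuous_cubicModel.comp (continuous_const.prodMk continuous_snd)
  convert isClosedMap_snd_of_compactSpace _ hcl using 1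
  ext p
  constructor
  · rintro ⟨s, hs, h⟩
    exact ⟨(⟨s, by simpa using hs⟩, p), h, rfl⟩
  · rintro ⟨⟨⟨s, hs⟩, p'⟩, h, rfl⟩
    exact ⟨s, by simpa using hs, h⟩

theorem measurable_roundData (hf : IsStochasticFunction D f) :
    Measurable fun p : Vec d × Round Ξ S n₁ n₂ =>
      (p.2.2.2, avgGradient f p.2.1 p.1, avgHessian f p.2.2.1 p.1) := by
  have h1 : Measurable fun p : Vec d × Round Ξ S n₁ n₂ => (p.1, p.2.1) := by fun_prop
  have h2 : Measurable fun p : Vec d × Round Ξ S n₁ n₂ => (p.1, p.2.2.1) := by fun_prop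
  have h3 : Measurable fun p : Vec d × Round Ξ S n₁ n₂ => p.2.2.2 := by fun_prop
  have hg := (hf.measurable_avgGradient n₁).comp h1
  have hB := (hf.measurable_avgHessian n₂).comp h2
  exact h3.prodMk (hg.prodMk hB)

theorem measurable_nextPoint (hf : IsStochasticFunction D f) (hA : A.IsMeasurable) :
    Measurable fun p : Vec d × Round Ξ S n₁ n₂ => nextPoint f A p.1 p.2 :=
  measurable_fst.add (hA.step.comp (measurable_roundData hf))

theorem measurable_roundDecrease (hf : IsStochasticFunction D f) (hA : A.IsMeasurable) :
    Measurable fun p : Vec d × Round Ξ S n₁ n₂ => roundDecrease f A p.1 p.2 :=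
  hA.decrease.comp (measurable_roundData hf)

theorem measurableSet_roundGood (hf : IsStochasticFunction D f) (hA : A.IsMeasurable)
    (hF : IsSmooth F ℓ ρ) :
    MeasurableSet {p : Vec d × Round Ξ S n₁ n₂ | RoundGood F f A ρ R η e₁ e₂ T p.1 p.2} := by
  have hdata := measurable_roundData (S := S) (n₁ := n₁) (n₂ := n₂) hf
  have hdec := measurable_roundDecrease (n₁ := n₁) (n₂ := n₂) hf hA
  have hnext := measurable_nextPoint (n₁ := n₁) (n₂ := n₂) hf hA
  have hFm := hF.differentiable.continuous.measurable
  have h1 : MeasurableSet {p : Vec d × Round Ξ S n₁ n₂ |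
      ‖avgGradient f p.2.1 p.1 - gradient F p.1‖ ≤ e₁} :=
    measurableSet_le
      (hdata.snd.fst.sub (hF.continuous_gradient.measurable.comp measurable_fst)).norm
      measurable_const
  have h2 : MeasurableSet {p : Vec d × Round Ξ S n₁ n₂ |
      ‖avgHessian f p.2.2.1 p.1 - hessian F p.1‖ ≤ e₂} :=
    measurableSet_le
      (hdata.snd.snd.sub (hF.continuous_hessian.measurable.comp measurable_fst)).norm
      measurable_const
  have h3 : MeasurableSet {p : Vec d × Round Ξ S n₁ n₂ |
      (A p.2.2.2 (avgGradient f p.2.1 p.1)).queries (avgHessian f p.2.2.1 p.1) ≤ T} :=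
    measurableSet_le (hA.queries.comp hdata) measurable_const
  have h4 : MeasurableSet {p : Vec d × Round Ξ S n₁ n₂ | -η ≤ roundDecrease f A p.1 p.2} :=
    measurableSet_le measurable_const hdec
  have h5 : MeasurableSet {p : Vec d × Round Ξ S n₁ n₂ |
      HasShortMinimizer ρ R (avgGradient f p.2.1 p.1) (avgHessian f p.2.2.1 p.1)} :=
    hdata.snd isClosed_hasShortMinimizer.measurableSet
  have h6 : MeasurableSet {p : Vec d × Round Ξ S n₁ n₂ | roundDecrease f A p.1 p.2 < -η} :=
    measurableSet_lt hdec measurable_const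
  have h7 : MeasurableSet {p : Vec d × Round Ξ S n₁ n₂ |
      F (nextPoint f A p.1 p.2) ≤ F p.1 - η / 4} :=
    measurableSet_le (hFm.comp hnext) ((hFm.comp measurable_fst).sub_const _)
  convert ((h1.inter h2).inter h3).inter ((h4.compl.union h5).inter (h6.compl.union h7)) using 1
  ext p
  simp only [Set.mem_ofPred_eq, Set.mem_inter_iff, Set.mem_union, Set.mem_compl_iff]
  constructor
  · rintro ⟨a1, a2, a3, a4, a5⟩
    exact ⟨⟨⟨a1, a2⟩, a3⟩, imp_iff_not_or.1 a4, imp_iff_not_or.1 a5⟩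
  · rintro ⟨⟨⟨a1, a2⟩, a3⟩, a4, a5⟩
    exact ⟨a1, a2, a3, imp_iff_not_or.2 a4, imp_iff_not_or.2 a5⟩

theorem measurableSet_allGood (hf : IsStochasticFunction D f) (hA : A.IsMeasurable)
    (hF : IsSmooth F ℓ ρ) (k N : ℕ) :
    MeasurableSet {p : Vec d × (Fin N → Round Ξ S n₁ n₂) |
      AllGood F f A ρ R η e₁ e₂ T k (List.ofFn p.2) p.1} := by
  induction k generalizing N with
  | zero => simp [AllGood]
  | succ k ih =>
    cases N with
    | zero => simp [AllGood]
    | succ N =>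
      have hfirst : Measurable fun p : Vec d × (Fin (N + 1) → Round Ξ S n₁ n₂) => (p.1, p.2 0) :=
        measurable_fst.prodMk ((measurable_pi_apply 0).comp measurable_snd)
      have hnext := (measurable_nextPoint hf hA).comp hfirst
      have hsucc : Measurable fun p : Vec d × (Fin (N + 1) → Round Ξ S n₁ n₂) =>
          fun i : Fin N => p.2 i.succ :=
        measurable_pi_lambda _ fun i => (measurable_pi_apply i.succ).comp measurable_snd
      have htail := hnext.prodMk hsucc
      have h1 := hfirst (measurableSet_roundGood (R := R) (η := η) (e₁ := e₁) (e₂ := e₂) (T := T)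
        hf hA hF)
      have hdec := (measurable_roundDecrease hf hA).comp hfirst
      have h2 : MeasurableSet {p : Vec d × (Fin (N + 1) → Round Ξ S n₁ n₂) |
          roundDecrease f A p.1 (p.2 0) < -η} := measurableSet_lt hdec measurable_const
      have h3 := htail (ih N)
      convert h1.inter (h2.compl.union h3) using 1
      ext p
      simp only [List.ofFn_succ, AllGood, Set.mem_ofPred_eq, Set.mem_inter_iff, Set.mem_union,
        Set.mem_compl_iff, Set.mem_preimage, Function.comp_apply, imp_iff_not_or]

end RoundsMeasurable

section Deterministic

variable {d : ℕ} {Ξ S : Type*} [MeasurableSpace Ξ] {D : Measure Ξ} {n₁ n₂ : ℕ}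
  {f : Vec d → Ξ → ℝ} {A : Subsolver S d} {F : Vec d → ℝ} {ℓ ρ r κ a fstar : ℝ} {T : ℕ}

/-- If the first `k` rounds are successful and `k` decreases of the objective are impossible, the
algorithm ends at a second-order stationary point within `k` rounds. -/
theorem metaAlgorithm_of_allGood (hf : IsStochasticFunction D f) (hF : IsSmooth F ℓ ρ)
    (hℓ : 0 < ℓ) (hρ : 0 < ρ) (hr : 0 < r) (ha : a ≤ 1 / 1000)
    (hlow : ∀ x, fstar ≤ F x) (k : ℕ) :
    ∀ (ws : List (Round Ξ S n₁ n₂)) (x : Vec d), k ≤ ws.length →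
      AllGood F f A ρ (r / 2) (κ * (ρ * r ^ 3)) (a * (ρ * r ^ 2)) (a * (ρ * r)) T k ws x →
      F x - fstar < k * (κ * (ρ * r ^ 3) / 4) →
      ∃ (y : Vec d) (N : ℕ), metaAlgorithm f A ℓ ρ (ρ * r ^ 2) κ ws x = some (y, N) ∧
        IsSecondOrderStationary F ρ (ρ * r ^ 2) y ∧
        (N : ℝ) ≤ k * (n₁ + n₂ * T) + n₂ * (40 * (ℓ ^ 2 / (ρ * (ρ * r ^ 2)))) := by
  induction k with
  | zero =>
    intro ws x _ _ h
    simp only [Nat.cast_zero, zero_mul] at h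
    linarith [hlow x]
  | succ k ih =>
    intro ws x hlen hgood hlt
    cases ws with
    | nil => simp at hlen
    | cons w ws =>
      obtain ⟨hg, hrest⟩ := hgood
      have hq : ((A w.2.2 (avgGradient f w.1 x)).queries (avgHessian f w.2.1 x) : ℝ) ≤ T :=
        Nat.cast_le.2 hg.queries_le
      have hq2 : (n₁ : ℝ) + n₂ * (A w.2.2 (avgGradient f w.1 x)).queries (avgHessian f w.2.1 x)
          ≤ n₁ + n₂ * T := by gcongr
      have hk0 : (0 : ℝ) ≤ k * (n₁ + n₂ * T) := by positivity
      rw [metaAlgorithm]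
      simp only [sqrt_eps_cube_div_rho hρ hr]
      by_cases hdec : -(κ * (ρ * r ^ 3)) ≤ roundDecrease f A x w
      · have hdec' : -(κ * (ρ * r ^ 3)) ≤
            (A w.2.2 (avgGradient f w.1 x)).decrease (avgHessian f w.2.1 x) := hdec
        rw [if_pos hdec']
        obtain ⟨s, hsr, hs⟩ := hg.short hdec
        have hsym := hf.isSymmetric_avgHessian w.2.1 x
        have hBℓ : ‖avgHessian f w.2.1 x‖ ≤ ℓ + ρ * r / 1000 := by
          have h1 : ‖avgHessian f w.2.1 x‖ ≤ ‖hessian F x‖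
              + ‖avgHessian f w.2.1 x - hessian F x‖ := by
            simpa using norm_add_le (hessian F x) (avgHessian f w.2.1 x - hessian F x)
          have h2 := hF.norm_hessian_le hℓ.le x
          have h3 : a * (ρ * r) ≤ 1 / 1000 * (ρ * r) := by gcongr
          linarith [hg.hessian_le]
        obtain ⟨Δ, N, hsol, hΔ, hgrad, hN⟩ := finalSolver_spec hℓ hρ hr rfl hsym hBℓ hs hsr
        refine ⟨x + Δ, _, by rw [hsol]; rfl, ?_, ?_⟩
        · exact isSecondOrderStationary_of_short hF hρ hr ha hsym hg.gradient_le hg.hessian_le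
            hs hsr hΔ hgrad
        · push_cast
          have h4 : (n₂ : ℝ) * N ≤ n₂ * (40 * (ℓ ^ 2 / (ρ * (ρ * r ^ 2)))) := by gcongr
          linarith
      · have hdec' : ¬ -(κ * (ρ * r ^ 3)) ≤
            (A w.2.2 (avgGradient f w.1 x)).decrease (avgHessian f w.2.1 x) := hdec
        rw [if_neg hdec']
        rw [not_le] at hdec
        have hdecr := hg.decrease hdec
        obtain ⟨y, N, hy, hy2, hN⟩ := ih ws (nextPoint f A x w)
          (by simpa using hlen) (hrest hdec) (by push_cast at hlt; linarith)
        have hy' : metaAlgorithm f A ℓ ρ (ρ * r ^ 2) κ ws (x + (A w.2.2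
            (avgGradient f w.1 x)).step (avgHessian f w.2.1 x)) = some (y, N) := hy
        refine ⟨y, _, by rw [hy']; rfl, hy2, ?_⟩
        push_cast
        linarith

end Deterministic

section Probability

variable {d : ℕ} {Ξ S : Type*} [MeasurableSpace Ξ] [MeasurableSpace S] {D : Measure Ξ}
  [IsProbabilityMeasure D] {ν : Measure S} [IsProbabilityMeasure ν]
  {n₁ n₂ : ℕ} {f : Vec d → Ξ → ℝ} {A : Subsolver S d} {F : Vec d → ℝ} {ρ R η e₁ e₂ ℓ : ℝ} {T : ℕ}

theorem prod_measure_le_of_slices {α β : Type*} [MeasurableSpace α] [MeasurableSpace β]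
    {μ : Measure α} [IsProbabilityMeasure μ] {μ' : Measure β} [SFinite μ'] {W : Set (α × β)}
    (hW : MeasurableSet W) {q : ENNReal} (h : ∀ a, μ' (Prod.mk a ⁻¹' W) ≤ q) :
    (μ.prod μ') W ≤ q := by
  rw [Measure.prod_apply hW]
  calc ∫⁻ a, μ' (Prod.mk a ⁻¹' W) ∂μ ≤ ∫⁻ _, q ∂μ := lintegral_mono h
    _ = q := by simp

/-- The failure probability of a single round. -/
theorem measure_not_roundGood_le (hf : IsStochasticFunction D f) (hA : A.IsMeasurable)
    (hF : IsSmooth F ℓ ρ) (x : Vec d) {p₁ p₂ q : ENNReal}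
    (h1 : (Measure.pi fun _ : Fin n₁ => D) {s | e₁ < ‖avgGradient f s x - gradient F x‖} ≤ p₁)
    (h2 : (Measure.pi fun _ : Fin n₂ => D) {s | e₂ < ‖avgHessian f s x - hessian F x‖} ≤ p₂)
    (h3 : ∀ (s₁ : Fin n₁ → Ξ) (s₂ : Fin n₂ → Ξ), ‖avgGradient f s₁ x - gradient F x‖ ≤ e₁ →
      ‖avgHessian f s₂ x - hessian F x‖ ≤ e₂ →
      ν {s | ¬ RoundGood F f A ρ R η e₁ e₂ T x ((s₁, s₂, s) : Round Ξ S n₁ n₂)} ≤ q) :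
    ((Measure.pi fun _ : Fin n₁ => D).prod ((Measure.pi fun _ : Fin n₂ => D).prod ν))
      {w | ¬ RoundGood F f A ρ R η e₁ e₂ T x w} ≤ p₁ + p₂ + q := by
  have hdata : Measurable fun w : Round Ξ S n₁ n₂ =>
      (w.2.2, avgGradient f w.1 x, avgHessian f w.2.1 x) :=
    (measurable_roundData (S := S) (n₁ := n₁) (n₂ := n₂) hf).comp measurable_prodMk_left
  have hm1 : MeasurableSet {w : Round Ξ S n₁ n₂ | ‖avgGradient f w.1 x - gradient F x‖ ≤ e₁} :=
    measurableSet_le (hdata.snd.fst.sub_const _).norm measurable_const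
  have hm2 : MeasurableSet {w : Round Ξ S n₁ n₂ | ‖avgHessian f w.2.1 x - hessian F x‖ ≤ e₂} :=
    measurableSet_le (hdata.snd.snd.sub_const _).norm measurable_const
  have hm3 : MeasurableSet {w : Round Ξ S n₁ n₂ | ¬ RoundGood F f A ρ R η e₁ e₂ T x w} :=
    (measurable_prodMk_left (measurableSet_roundGood hf hA hF)).compl
  set E₁ : Set (Fin n₁ → Ξ) := {s | e₁ < ‖avgGradient f s x - gradient F x‖} with hE₁
  set E₂ : Set (Fin n₂ → Ξ) := {s | e₂ < ‖avgHessian f s x - hessian F x‖} with hE₂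
  set W : Set (Round Ξ S n₁ n₂) := ({w | ‖avgGradient f w.1 x - gradient F x‖ ≤ e₁} ∩
    {w | ‖avgHessian f w.2.1 x - hessian F x‖ ≤ e₂}) ∩
    {w | ¬ RoundGood F f A ρ R η e₁ e₂ T x w} with hW
  have hsub : {w : Round Ξ S n₁ n₂ | ¬ RoundGood F f A ρ R η e₁ e₂ T x w} ⊆
      (E₁ ×ˢ Set.univ ∪ Set.univ ×ˢ (E₂ ×ˢ Set.univ)) ∪ W := by
    intro w hw
    by_cases hg : e₁ < ‖avgGradient f w.1 x - gradient F x‖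
    · exact Or.inl (Or.inl ⟨hg, trivial⟩)
    by_cases hB : e₂ < ‖avgHessian f w.2.1 x - hessian F x‖
    · exact Or.inl (Or.inr ⟨trivial, hB, trivial⟩)
    exact Or.inr ⟨⟨not_lt.1 hg, not_lt.1 hB⟩, hw⟩
  refine (measure_mono hsub).trans ((measure_union_le _ _).trans
    (add_le_add ((measure_union_le _ _).trans (add_le_add ?_ ?_)) ?_))
  · rw [Measure.prod_prod, measure_univ, mul_one]
    exact h1
  · rw [Measure.prod_prod, Measure.prod_prod, measure_univ, measure_univ, mul_one, one_mul]
    exact h2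
  · have hWm : MeasurableSet W := (hm1.inter hm2).inter hm3
    refine prod_measure_le_of_slices hWm fun s₁ =>
      prod_measure_le_of_slices (measurable_prodMk_left hWm) fun s₂ => ?_
    by_cases hacc : ‖avgGradient f s₁ x - gradient F x‖ ≤ e₁ ∧
        ‖avgHessian f s₂ x - hessian F x‖ ≤ e₂
    · exact (measure_mono fun s hs => hs.2).trans (h3 s₁ s₂ hacc.1 hacc.2)
    · refine le_of_eq_of_le ?_ zero_le
      refine measure_mono_null (fun s hs => ?_) measure_empty
      exact hacc ⟨hs.1.1, hs.1.2⟩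

/-- Union bound over the first `k` rounds. The iterate at which a round starts depends only on the
earlier rounds, so that the bound for a single round applies conditionally on them. -/
theorem roundsLaw_not_allGood_le (hf : IsStochasticFunction D f) (hA : A.IsMeasurable)
    (hF : IsSmooth F ℓ ρ) {p : ENNReal}
    (h : ∀ x, ((Measure.pi fun _ : Fin n₁ => D).prod ((Measure.pi fun _ : Fin n₂ => D).prod ν))
      {w | ¬ RoundGood F f A ρ R η e₁ e₂ T x w} ≤ p) (k : ℕ) :
    ∀ (N : ℕ) (x : Vec d), roundsLaw D ν n₁ n₂ N
      {ω | ¬ AllGood F f A ρ R η e₁ e₂ T k (List.ofFn ω) x} ≤ k * p := by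
  induction k with
  | zero => intro N x; simp [AllGood]
  | succ k ih =>
    intro N x
    cases N with
    | zero => simp [AllGood]
    | succ N =>
      set μ : Measure (Round Ξ S n₁ n₂) :=
        (Measure.pi fun _ : Fin n₁ => D).prod ((Measure.pi fun _ : Fin n₂ => D).prod ν) with hμ
      have hbad : MeasurableSet {w : Round Ξ S n₁ n₂ | ¬ RoundGood F f A ρ R η e₁ e₂ T x w} :=
        (measurable_prodMk_left (measurableSet_roundGood hf hA hF)).compl
      have hms : MeasurableSet {ω : Fin (N + 1) → Round Ξ S n₁ n₂ |
          ¬ AllGood F f A ρ R η e₁ e₂ T (k + 1) (List.ofFn ω) x} :=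
        (measurable_prodMk_left (measurableSet_allGood hf hA hF (k + 1) (N + 1))).compl
      unfold roundsLaw
      rw [← lintegral_indicator_one hms, lintegral_pi_succ μ (measurable_one.indicator hms)]
      calc _ ≤ ∫⁻ w, ({w | ¬ RoundGood F f A ρ R η e₁ e₂ T x w}.indicator 1 w + k * p) ∂μ := by
            refine lintegral_mono fun w => ?_
            have hsl : ∫⁻ t : Fin N → Round Ξ S n₁ n₂, {ω : Fin (N + 1) → Round Ξ S n₁ n₂ |
                ¬ AllGood F f A ρ R η e₁ e₂ T (k + 1) (List.ofFn ω) x}.indicator 1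
                  (Fin.cons w t : Fin (N + 1) → Round Ξ S n₁ n₂) ∂(Measure.pi fun _ => μ)
                = (Measure.pi fun _ : Fin N => μ) {t | ¬ AllGood F f A ρ R η e₁ e₂ T (k + 1)
                    (List.ofFn (Fin.cons w t : Fin (N + 1) → Round Ξ S n₁ n₂)) x} := by
              rw [← lintegral_indicator_one]
              · rfl
              · exact (measurable_cons.comp measurable_prodMk_left) hms
            rw [hsl]
            by_cases hw : RoundGood F f A ρ R η e₁ e₂ T x w
            · refine le_trans ?_ (le_add_left (ih N (nextPoint f A x w)))
              refine measure_mono fun t ht hall => ht ?_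
              simp only [List.ofFn_succ, Fin.cons_zero, Fin.cons_succ, AllGood]
              exact ⟨hw, fun _ => hall⟩
            · refine prob_le_one.trans (le_add_right ?_)
              rw [Set.indicator_of_mem (show w ∈ {w | ¬ _} from hw)]
              rfl
        _ = μ {w | ¬ RoundGood F f A ρ R η e₁ e₂ T x w} + k * p := by
            rw [lintegral_add_right _ measurable_const, lintegral_indicator_one hbad]
            simp
        _ ≤ p + k * p := by gcongr; exact h x
        _ = _ := by push_cast; ring

end Probability

/-! ### Constants, thresholds and the complexity bound -/

section Constants

theorem outerScale_mul {ρ r : ℝ} (hρ : 0 < ρ) (hr : 0 < r) (Δf : ℝ) :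
    outerScale ρ (ρ * r ^ 2) Δf * (ρ * r ^ 3) = Δf := by
  have h1 : (ρ * r ^ 2) ^ (3 / 2 : ℝ) = √ρ * (ρ * r ^ 3) := by
    have h2 : (ρ * r ^ 2) ^ (3 / 2 : ℝ) = √(ρ * r ^ 2) ^ 3 := by
      rw [Real.sqrt_eq_rpow, ← Real.rpow_mul_natCast (by positivity)]
      norm_num
    rw [h2, Real.sqrt_mul hρ.le, Real.sqrt_sq hr.le]
    have h3 := Real.sq_sqrt hρ.le
    calc (√ρ * r) ^ 3 = √ρ * (√ρ ^ 2 * r ^ 3) := by ring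
      _ = _ := by rw [h3]
  have h4 : 0 < √ρ := Real.sqrt_pos.2 hρ
  rw [outerScale, h1]
  field_simp

theorem logFactor_eq (d : ℕ) (ρ ε Δf δ c : ℝ) :
    logFactor d ρ ε Δf δ c = Real.log (d * outerScale ρ ε Δf / (δ * c)) := by
  rw [logFactor, outerScale]
  congr 1
  rw [mul_div_assoc', div_div, mul_assoc, mul_assoc (ε ^ (3 / 2 : ℝ))]

theorem exp_neg_logFactor {d : ℕ} {ρ ε Δf δ c : ℝ} (hd : 0 < d) (hX : 1 ≤ outerScale ρ ε Δf)
    (hδ : 0 < δ) (hc : 0 < c) :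
    d * Real.exp (-logFactor d ρ ε Δf δ c) = c * δ / outerScale ρ ε Δf := by
  have hd' : (0 : ℝ) < d := by exact_mod_cast hd
  rw [logFactor_eq, Real.exp_neg, Real.exp_log (by positivity)]
  field_simp

theorem one_le_logFactor {d : ℕ} {ρ ε Δf δ c : ℝ} (hd : 0 < d) (hX : 1 ≤ outerScale ρ ε Δf)
    (hδ : 0 < δ) (hδ1 : δ ≤ 1) (hc : 0 < c) (hc' : c ≤ 1 / 30) :
    1 ≤ logFactor d ρ ε Δf δ c := by
  have hd' : (1 : ℝ) ≤ d := by exact_mod_cast hd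
  have hdX : 1 ≤ d * outerScale ρ ε Δf := one_le_mul_of_one_le_of_one_le hd' hX
  rw [logFactor_eq, Real.le_log_iff_exp_le (by positivity), le_div_iff₀ (by positivity)]
  have h1 := Real.exp_one_lt_d9
  have h2 : δ * c ≤ 1 * (1 / 30) := by gcongr
  have h3 : Real.exp 1 * (δ * c) ≤ 3 * (1 * (1 / 30)) := by gcongr; linarith
  linarith

/-- A minibatch above the threshold is large enough for Bernstein's inequality at accuracy `a e`,
if the constant `c` of the threshold is much smaller than `a`. -/
theorem bernstein_of_threshold {M σ c e a Λ n : ℝ} (hc : 0 < c) (he : 0 < e) (hΛ : 0 ≤ Λ)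
    (hM : 0 ≤ M) (hca : 10 * c ≤ a)
    (h : max (M / (c * e)) (σ ^ 2 / (c ^ 2 * e ^ 2)) * Λ ≤ n) :
    8 * Λ * M ≤ n * (a * e) ∧ 64 * Λ * σ ^ 2 ≤ n * (a * e) ^ 2 := by
  have h1 : M / (c * e) * Λ ≤ n := (mul_le_mul_of_nonneg_right (le_max_left _ _) hΛ).trans h
  have h2 : σ ^ 2 / (c ^ 2 * e ^ 2) * Λ ≤ n :=
    (mul_le_mul_of_nonneg_right (le_max_right _ _) hΛ).trans h
  have hn : 0 ≤ n := le_trans (by positivity) h1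
  have h3 : 10 * c * e ≤ a * e := by gcongr
  have h4 : 0 ≤ M * Λ := by positivity
  have h5 : 0 ≤ σ ^ 2 * Λ := by positivity
  constructor
  · calc 8 * Λ * M ≤ 10 * (M * Λ) := by linarith
      _ = M / (c * e) * Λ * (10 * c * e) := by field_simp
      _ ≤ n * (a * e) := by gcongr
  · calc 64 * Λ * σ ^ 2 ≤ 100 * (σ ^ 2 * Λ) := by linarith
      _ = σ ^ 2 / (c ^ 2 * e ^ 2) * Λ * (10 * c * e) ^ 2 := by field_simp; ring
      _ ≤ n * (a * e) ^ 2 := by gcongr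

theorem max_threshold_le {M σ c e : ℝ} (hc : 0 < c) (hc1 : c ≤ 1) (he : 0 < e) (hM : 0 ≤ M) :
    max (M / (c * e)) (σ ^ 2 / (c ^ 2 * e ^ 2)) ≤ max (M / e) (σ ^ 2 / e ^ 2) / c ^ 2 := by
  rw [le_div_iff₀ (by positivity), max_mul_of_nonneg _ _ (by positivity)]
  refine max_le_max ?_ (le_of_eq (by field_simp))
  calc M / (c * e) * c ^ 2 = M / e * c := by field_simp
    _ ≤ M / e * 1 := by gcongr
    _ = _ := mul_one _

theorem gradThreshold_le {d : ℕ} {ρ ε Δf δ c σ M : ℝ} (hc : 0 < c) (hc1 : c ≤ 1) (he : 0 < ε)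
    (hM : 0 ≤ M) (hL : 1 ≤ logFactor d ρ ε Δf δ c) :
    gradThreshold d ρ ε Δf δ c σ M + 1
      ≤ (1 + gradScale ε σ M) * logFactor d ρ ε Δf δ c / c ^ 2 := by
  have h1 := mul_le_mul_of_nonneg_right (max_threshold_le (σ := σ) hc hc1 he hM)
    (zero_le_one.trans hL)
  have h2 : 1 ≤ logFactor d ρ ε Δf δ c / c ^ 2 := by
    rw [le_div_iff₀ (by positivity)]
    nlinarith
  unfold gradThreshold gradScale
  calc _ ≤ max (M / ε) (σ ^ 2 / ε ^ 2) / c ^ 2 * logFactor d ρ ε Δf δ c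
        + logFactor d ρ ε Δf δ c / c ^ 2 := by linarith
    _ = _ := by ring

theorem hessThreshold_eq (d : ℕ) {ρ ε : ℝ} (Δf δ c σ M : ℝ) (hρ : 0 < ρ) (hε : 0 < ε) :
    hessThreshold d ρ ε Δf δ c σ M
      = max (M / (c * √(ρ * ε))) (σ ^ 2 / (c ^ 2 * √(ρ * ε) ^ 2)) * logFactor d ρ ε Δf δ c := by
  rw [hessThreshold, Real.sq_sqrt (by positivity), mul_assoc]

theorem hessThreshold_le {d : ℕ} {ρ ε Δf δ c σ M : ℝ} (hρ : 0 < ρ) (hc : 0 < c) (hc1 : c ≤ 1)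
    (he : 0 < ε) (hM : 0 ≤ M) (hL : 1 ≤ logFactor d ρ ε Δf δ c) :
    hessThreshold d ρ ε Δf δ c σ M + 1
      ≤ (1 + hessScale ρ ε σ M) * logFactor d ρ ε Δf δ c / c ^ 2 := by
  have h1 := mul_le_mul_of_nonneg_right (max_threshold_le (σ := σ) hc hc1
    (Real.sqrt_pos.2 (mul_pos hρ he)) hM) (zero_le_one.trans hL)
  have h2 : 1 ≤ logFactor d ρ ε Δf δ c / c ^ 2 := by
    rw [le_div_iff₀ (by positivity)]
    nlinarith
  rw [hessThreshold_eq d Δf δ c σ M hρ he]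
  unfold hessScale
  rw [Real.sq_sqrt (by positivity)] at h1 ⊢
  calc _ ≤ max (M / √(ρ * ε)) (σ ^ 2 / (ρ * ε)) / c ^ 2 * logFactor d ρ ε Δf δ c
        + logFactor d ρ ε Δf δ c / c ^ 2 := by linarith
    _ = _ := by ring

/-- From the cost in terms of the batch sizes to the cost in terms of the noise levels. -/
theorem cost_le_of_batch_le {N X n₁ n₂ T Q G H Λ c C₀ : ℝ} (hc : 0 < c) (hC₀ : 0 < C₀)
    (hX : 0 ≤ X) (hT : 0 ≤ T) (hQ : 0 ≤ Q) (hG : 0 ≤ G) (hH : 0 ≤ H) (hΛ : 0 ≤ Λ)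
    (hN : N ≤ C₀ * (X * (n₁ + n₂ * T) + n₂ * Q))
    (hn₁ : n₁ ≤ (1 + G) * Λ / c ^ 2) (hn₂ : n₂ ≤ (1 + H) * Λ / c ^ 2) :
    N ≤ 2 * C₀ / c ^ 2 * Λ * (X * ((1 + G) + (1 + H) * T) + (1 + H) * Q) ∧
      (Q ≤ X * T → N ≤ 2 * C₀ / c ^ 2 * Λ * (X * ((1 + G) + (1 + H) * T))) := by
  have h1 : N ≤ C₀ / c ^ 2 * Λ * (X * ((1 + G) + (1 + H) * T) + (1 + H) * Q) := by
    refine hN.trans ?_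
    calc C₀ * (X * (n₁ + n₂ * T) + n₂ * Q)
        ≤ C₀ * (X * ((1 + G) * Λ / c ^ 2 + (1 + H) * Λ / c ^ 2 * T)
          + (1 + H) * Λ / c ^ 2 * Q) := by gcongr
      _ = _ := by ring
  have hA : 0 ≤ C₀ / c ^ 2 * Λ := by positivity
  have hB : 0 ≤ X * ((1 + G) + (1 + H) * T) := by positivity
  have hD : 0 ≤ (1 + H) * Q := by positivity
  have h2 : 2 * C₀ / c ^ 2 * Λ = 2 * (C₀ / c ^ 2 * Λ) := by ring
  rw [h2]
  refine ⟨h1.trans ?_, fun hQT => h1.trans ?_⟩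
  · have := mul_nonneg hA (add_nonneg hB hD)
    linarith
  · have h3 : (1 + H) * Q ≤ X * ((1 + G) + (1 + H) * T) := by
      have h4 : (1 + H) * Q ≤ (1 + H) * (X * T) := by gcongr
      have h5 : 0 ≤ X * (1 + G) := by positivity
      nlinarith
    have := mul_le_mul_of_nonneg_left h3 hA
    linarith

end Constants

section Assembly

variable {d : ℕ} {Ξ S : Type*} [MeasurableSpace Ξ] [MeasurableSpace S] {D : Measure Ξ}
  {ν : Measure S} {n₁ n₂ : ℕ} {f : Vec d → Ξ → ℝ} {A : Subsolver S d}

/-- On accurate data, a round can fail only if the call of the subsolver fails. -/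
theorem measure_not_roundGood_slice_le {F : Vec d → ℝ} {ℓ ρ r K κ τ c a q : ℝ} {T : ℕ}
    (hf : IsStochasticFunction D f) (hF : IsSmooth F ℓ ρ) (hρ : 0 < ρ) (hr : 0 < r)
    (hκ : 0 < κ) (hκ' : κ ≤ 1 / 100) (hκK : κ < K) (hc : c ≤ 1 / 30) (ha : 0 ≤ a)
    (haτ : a ≤ τ) (haκ : a ≤ κ / 10)
    (hsub : SubsolverCondition ν F ρ (ρ * r ^ 2) K τ c T q A) (x : Vec d)
    (s₁ : Fin n₁ → Ξ) (s₂ : Fin n₂ → Ξ)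
    (h1 : ‖avgGradient f s₁ x - gradient F x‖ ≤ a * (ρ * r ^ 2))
    (h2 : ‖avgHessian f s₂ x - hessian F x‖ ≤ a * (ρ * r)) :
    ν {s | ¬ RoundGood F f A ρ (r / 2) (κ * (ρ * r ^ 3)) (a * (ρ * r ^ 2)) (a * (ρ * r)) T x
      ((s₁, s₂, s) : Round Ξ S n₁ n₂)} ≤ ENNReal.ofReal q := by
  have hsym := hf.isSymmetric_avgHessian s₂ x
  refine le_trans (measure_mono ?_)
    (hsub x (avgGradient f s₁ x) (avgHessian f s₂ x) hsym (h1.trans (by gcongr))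
      (h2.trans (by rw [sqrt_rho_mul_eps hρ hr]; gcongr)))
  intro s hs hcall
  refine hs ⟨h1, h2, hcall.1, fun hdec => ?_, fun hdec => ?_⟩
  · exact hcall.exists_short_minimizer hρ hr hκ' hκK hc hsym hdec
  · have := hcall.objective_decrease hF hρ hr hκ hκ' hκK hc ha haκ hsym h1 h2 hdec
    refine this.trans (le_of_eq ?_)
    ring

theorem nonneg_of_ae_norm_le [IsProbabilityMeasure D] {V : Type*} [NormedAddCommGroup V]
    {Y : Ξ → V} {M : ℝ}
    (h : ∀ᵐ ξ ∂D, ‖Y ξ‖ ≤ M) : 0 ≤ M := by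
  obtain ⟨ξ, hξ⟩ := h.exists
  exact (norm_nonneg _).trans hξ

end Assembly

end StochCubic

end

open StochCubic in
theorem theorem1 (K κ τ : ℝ) (hκ : 0 < κ) (hκ' : κ ≤ 1 / 100) (hκK : κ < K) (hτ : 0 < τ) :
    ∃ c C : ℝ, 0 < c ∧ 0 < C ∧
      ∀ (d : ℕ) (_ : 0 < d)
        (Ξ : Type*) (_ : MeasurableSpace Ξ) (D : MeasureTheory.Measure Ξ)
        (_ : MeasureTheory.IsProbabilityMeasure D)
        (S : Type*) (_ : MeasurableSpace S) (ν : MeasureTheory.Measure S)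
        (_ : MeasureTheory.IsProbabilityMeasure ν)
        (f : Vec d → Ξ → ℝ) (A : Subsolver S d) (x₀ : Vec d)
        (ℓ ρ ε δ fstar Δf σ₁ M₁ σ₂ M₂ : ℝ) (n₁ n₂ Tout T : ℕ),
        0 < ℓ → 0 < ρ → 0 < ε → 0 < δ →
        IsStochasticFunction D f →
        IsSmooth (objective D f) ℓ ρ →
        HasBoundedNoise D f σ₁ M₁ σ₂ M₂ →
        (∀ x, fstar ≤ objective D f x) →
        objective D f x₀ - fstar ≤ Δf →
        1 ≤ outerScale ρ ε Δf →
        A.IsMeasurable →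
        SubsolverCondition ν (objective D f) ρ ε K τ c T (c * δ / outerScale ρ ε Δf) A →
        1 ≤ n₁ → gradThreshold d ρ ε Δf δ c σ₁ M₁ ≤ n₁ →
        1 ≤ n₂ → hessThreshold d ρ ε Δf δ c σ₂ M₂ ≤ n₂ →
        outerScale ρ ε Δf / c ≤ Tout →
        roundsLaw D ν n₁ n₂ (Tout + 1)
          {ω | ¬ ∃ (x : Vec d) (N : ℕ),
            metaAlgorithm f A ℓ ρ ε κ (List.ofFn ω) x₀ = some (x, N) ∧
            IsSecondOrderStationary (objective D f) ρ ε x ∧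
            (N : ℝ) ≤ C * (outerScale ρ ε Δf * (n₁ + n₂ * T) + n₂ * (ℓ ^ 2 / (ρ * ε))) ∧
            ((n₁ : ℝ) ≤ gradThreshold d ρ ε Δf δ c σ₁ M₁ + 1 →
              (n₂ : ℝ) ≤ hessThreshold d ρ ε Δf δ c σ₂ M₂ + 1 →
              (N : ℝ) ≤ C * logFactor d ρ ε Δf δ c *
                (outerScale ρ ε Δf *
                    ((1 + gradScale ε σ₁ M₁) + (1 + hessScale ρ ε σ₂ M₂) * T) +
                  (1 + hessScale ρ ε σ₂ M₂) * (ℓ ^ 2 / (ρ * ε))) ∧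
              (ℓ ^ 2 / (ρ * ε) ≤ outerScale ρ ε Δf * T →
                (N : ℝ) ≤ C * logFactor d ρ ε Δf δ c *
                  (outerScale ρ ε Δf *
                    ((1 + gradScale ε σ₁ M₁) + (1 + hessScale ρ ε σ₂ M₂) * T))))} ≤
          ENNReal.ofReal δ := by
  -- `a` is the accuracy of the averages; the number of rounds is at most `C₀` times the scale `X`.
  set a : ℝ := min τ (κ / 10) with ha_def
  have ha0 : 0 < a := lt_min hτ (by positivity)
  have haτ : a ≤ τ := min_le_left _ _
  have haκ : a ≤ κ / 10 := min_le_right _ _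
  set C₀ : ℝ := 4 / κ + 1 with hC₀_def
  have hC₀ : 40 ≤ C₀ := by
    have : 400 ≤ 4 / κ := by rw [le_div_iff₀ hκ]; linarith
    linarith
  set c : ℝ := min (a / 10) (1 / (5 * C₀)) with hc_def
  have hc0 : 0 < c := lt_min (by positivity) (by positivity)
  have hca : 10 * c ≤ a := by
    have : c ≤ a / 10 := min_le_left _ _
    linarith
  have hcC : c * (5 * C₀) ≤ 1 := by
    have : c ≤ 1 / (5 * C₀) := min_le_right _ _
    rwa [le_div_iff₀ (by positivity)] at this
  have hc30 : c ≤ 1 / 30 := by linarith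
  have hc1 : c ≤ 1 := by linarith
  refine ⟨c, 2 * C₀ / c ^ 2, hc0, by positivity, ?_⟩
  intro d hd Ξ _ D _ S _ ν _ f A x₀ ℓ ρ ε δ fstar Δf σ₁ M₁ σ₂ M₂ n₁ n₂ Tout T hℓ hρ hε hδ hf hF hN
    hlow hΔ hX hA hsub hn₁ hN₁ hn₂ hN₂ hTout
  have hprob : IsProbabilityMeasure (roundsLaw D ν n₁ n₂ (Tout + 1)) := by
    unfold roundsLaw; infer_instance
  rcases le_or_gt 1 δ with hδ1 | hδ1
  · exact prob_le_one.trans (by simpa using hδ1)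
  -- The unit of length of the problem.
  obtain ⟨r, hr, rfl⟩ : ∃ r : ℝ, 0 < r ∧ ε = ρ * r ^ 2 :=
    ⟨√(ε / ρ), Real.sqrt_pos.2 (by positivity), by
      rw [Real.sq_sqrt (by positivity)]; field_simp⟩
  set F := objective D f with hF_def
  set X := outerScale ρ (ρ * r ^ 2) Δf with hX_def
  set Λ := logFactor d ρ (ρ * r ^ 2) Δf δ c with hΛ_def
  have hM₁ : 0 ≤ M₁ := nonneg_of_ae_norm_le (hN.gradient_bounded 0)
  have hM₂ : 0 ≤ M₂ := nonneg_of_ae_norm_le (hN.hessian_bounded 0)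
  have hΛ1 : 1 ≤ Λ := one_le_logFactor hd hX hδ hδ1.le hc0 hc30
  have hΛ0 : 0 < Λ := by linarith
  have hXΔ : X * (ρ * r ^ 3) = Δf := outerScale_mul hρ hr Δf
  have hexp : d * Real.exp (-Λ) = c * δ / X := exp_neg_logFactor hd hX hδ hc0
  have hρr : 0 < ρ * r := by positivity
  -- The failure probability of one round.
  have hround : ∀ x, ((Measure.pi fun _ : Fin n₁ => D).prod
      ((Measure.pi fun _ : Fin n₂ => D).prod ν)) {w | ¬ RoundGood F f A ρ (r / 2)
        (κ * (ρ * r ^ 3)) (a * (ρ * r ^ 2)) (a * (ρ * r)) T x w}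
      ≤ ENNReal.ofReal (5 * (c * δ / X)) := by
    intro x
    obtain ⟨b1, b2⟩ := bernstein_of_threshold hc0 hε hΛ0.le hM₁ hca hN₁
    rw [hessThreshold_eq d Δf δ c σ₂ M₂ hρ hε, sqrt_rho_mul_eps hρ hr] at hN₂
    obtain ⟨b3, b4⟩ := bernstein_of_threshold hc0 hρr hΛ0.le hM₂ hca hN₂
    have b3' : 4 * Λ * M₂ ≤ n₂ * (a * (ρ * r)) := by
      have : 0 ≤ Λ * M₂ := by positivity
      linarith
    have b4' : 16 * Λ * σ₂ ^ 2 ≤ n₂ * (a * (ρ * r)) ^ 2 := by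
      have : 0 ≤ Λ * σ₂ ^ 2 := by positivity
      linarith
    refine (measure_not_roundGood_le hf hA hF x
      (measure_avgGradient_gt_le hd hf hF hN hn₁ (by positivity) hΛ0 b1 b2 x)
      (measure_avgHessian_gt_le hf hF hN hn₂ (by positivity) hΛ0 b3' b4' x)
      (fun s₁ s₂ => measure_not_roundGood_slice_le hf hF hρ hr hκ hκ' hκK hc30 ha0.le haτ haκ
        hsub x s₁ s₂)).trans ?_
    rw [mul_assoc, hexp, ← ENNReal.ofReal_add (by positivity) (by positivity),
      ← ENNReal.ofReal_add (by positivity) (by positivity)]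
    exact ENNReal.ofReal_le_ofReal (by linarith)
  -- The objective can decrease by `κ ρ r ^ 3 / 4` in fewer than `k` rounds.
  set k : ℕ := ⌊X * (4 / κ)⌋₊ + 1 with hk_def
  have hk1 : (k : ℝ) ≤ C₀ * X := by
    rw [hk_def]
    push_cast
    have := Nat.floor_le (by positivity : 0 ≤ X * (4 / κ))
    rw [hC₀_def]
    linarith
  have hk2 : X * (4 / κ) < k := by
    rw [hk_def]
    push_cast
    exact Nat.lt_floor_add_one _
  have hk3 : k ≤ Tout + 1 := by
    have h1 : X * (4 / κ) ≤ Tout := by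
      refine le_trans ?_ hTout
      rw [le_div_iff₀ hc0]
      have h2 : 4 / κ * c ≤ 1 := by
        have h3 : 4 / κ * c ≤ 5 * C₀ * c := by gcongr; linarith
        linarith
      calc X * (4 / κ) * c = X * (4 / κ * c) := by ring
        _ ≤ X * 1 := by gcongr
        _ = X := mul_one X
    have h4 := Nat.floor_le_of_le h1
    omega
  have hstart : F x₀ - fstar < k * (κ * (ρ * r ^ 3) / 4) := by
    refine hΔ.trans_lt ?_
    calc Δf = X * (4 / κ) * (κ * (ρ * r ^ 3) / 4) := by rw [← hXΔ]; field_simp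
      _ < _ := by gcongr
  refine le_trans (measure_mono ?_)
    ((roundsLaw_not_allGood_le (ν := ν) hf hA hF hround k (Tout + 1) x₀).trans ?_)
  · intro ω hω hall
    apply hω
    obtain ⟨y, N, hy, hstat, hcost⟩ := metaAlgorithm_of_allGood hf hF hℓ hρ hr
      (by linarith) hlow k (List.ofFn ω) x₀ (by simpa using hk3) hall hstart
    set Q := ℓ ^ 2 / (ρ * (ρ * r ^ 2)) with hQ_def
    have hQ0 : 0 ≤ Q := by positivity
    have hcost' : (N : ℝ) ≤ C₀ * (X * (n₁ + n₂ * T) + n₂ * Q) := by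
      have h1 : (k : ℝ) * (n₁ + n₂ * T) ≤ C₀ * X * (n₁ + n₂ * T) := by gcongr
      have h2 : (n₂ : ℝ) * (40 * Q) ≤ n₂ * (C₀ * Q) := by gcongr
      linarith
    refine ⟨y, N, hy, hstat, ?_, fun hb₁ hb₂ => ?_⟩
    · refine hcost'.trans ?_
      gcongr
      rw [le_div_iff₀ (by positivity)]
      have : c ^ 2 ≤ 1 := pow_le_one₀ hc0.le hc1
      nlinarith
    · exact cost_le_of_batch_le hc0 (by positivity) (by positivity) (Nat.cast_nonneg T) hQ0
        (le_max_of_le_left (by positivity)) (le_max_of_le_left (by positivity)) hΛ0.le hcost'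
        (hb₁.trans (gradThreshold_le hc0 hc1 hε hM₁ hΛ1))
        (hb₂.trans (hessThreshold_le hρ hc0 hc1 hε hM₂ hΛ1))
  · rw [← ENNReal.ofReal_natCast, ← ENNReal.ofReal_mul (by positivity)]
    refine ENNReal.ofReal_le_ofReal ?_
    calc (k : ℝ) * (5 * (c * δ / X)) ≤ C₀ * X * (5 * (c * δ / X)) := by gcongr
      _ = c * (5 * C₀) * δ := by field_simp
      _ ≤ 1 * δ := by gcongr
      _ = δ := one_mul δ
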